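/- For a set $A$ of integers, each at least $3$, let $\mathscr{C}_A=\{C_a : a\in A\}$, where $C_a$ is the cycle of length $a$. Let $ex(n,C_4,\mathscr{C}_A)$ be the maximum number of copies of $C_4$ (i.e. subgraphs isomorphic to $C_4$) in a simple graph on $n$ vertices that contains no member of $\mathscr{C}_A$ as a (not necessarily induced) subgraph. Then for every nonempty (finite or infinite) such $A$, with $A$ fixed and $n\to\infty$: (1) if $4\in A$, then $ex(n,C_4,\mathscr{C}_A)=0$ for every $n$; (2) if $4\notin A$ and $A$ has an even element, the least of which is $2k$ (so $k\ge 3$), then $ex(n,C_4,\mathscr{C}_A)=(1+o(1))\,\frac{(k-1)(k-2)}{4}\,n^2$; (3) if $A$ has no even element, then $ex(n,C_4,\mathscr{C}_A)=(1+o(1))\,\frac{1}{64}\,n^4$. -/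

import Mathlib

open Filter Asymptotics

/-- `G` is `F`-free for a family `F` of graphs: no member of `F` is isomorphic to a
(not necessarily induced) subgraph of `G`. -/
def FamilyFree {ι : Type} {W : ι → Type} (F : ∀ i, SimpleGraph (W i)) {V : Type}
    (G : SimpleGraph V) : Prop :=
  ∀ i, (F i).Free G

open Classical in
/-- The generalized Turán number `ex(n, H, F)`: the maximum, over all `F`-free graphs `G` on `n`
vertices, of the number of copies of `H` in `G` (subgraphs of `G` isomorphic to `H`). -/
noncomputable def generalizedTuran (n : ℕ) {U : Type} (H : SimpleGraph U)
    {ι : Type} {W : ι → Type} (F : ∀ i, SimpleGraph (W i)) : ℕ :=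
  ({G : SimpleGraph (Fin n) | FamilyFree F G} : Finset _).sup fun G => G.copyCount H

/-- The family of cycles `{C_a : a ∈ A}`. -/
def cycleFamily (A : Set ℕ) (a : A) : SimpleGraph (Fin (a : ℕ)) :=
  SimpleGraph.cycleGraph (a : ℕ)

/-! Copies of C₄ are counted through labelled four-cycles (a, b, c, d), eight per copy. The lower
bounds come from complete bipartite graphs, which have no odd cycle: with a side of size k - 1 there
is no even cycle of length 2k or more, and there are about (k-1)(k-2)/4 · n² four-cycles; with
balanced sides there are about n⁴/64.

Upper bound, even case. In a C_{2k}-free graph with k ≥ 3, arguments on breadth-first layers in the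
style of Bondy and Simonovits give Σ d(v)² = O(n²) and O(n²) walks of length three. Let H be the
vertices of degree at least εn and L the others. The first bound makes |H| bounded; the second makes
the sum of d(v)² over L a small multiple of n² (`mul_sum_degree_sq_le`). Only boundedly many
vertices are rich, that is, have k neighbours in H (`card_rich_le`). A four-cycle with an opposite
pair in H is given by its other pair, in at most n² ways, and, unless that pair is rich, by an
ordered pair among at most k - 1 common neighbours in H. The two choices of the diagonal give the
main term 2(k-1)(k-2)n². Every other four-cycle has an edge inside L, and these are few
(`fourCycleCount_low_le`): an opposite pair of bounded codegree costs only a constant times the sum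
of d² over L, and pairs of large codegree ("fat") are linearly many inside a neighbourhood, since a
path of fat pairs there subdivides to a path that closes to C_{2k}.

Upper bound, odd case. Without C_{2l+1}, a neighbourhood has no path on 2l vertices, so there are
O(n²) triangles. As d(a) + d(b) ≤ n + codeg(a, b), Mantel's argument survives up to lower-order
terms: Σ d(v) ≤ n²/2 + O(n), and d(a)d(b), which bounds the four-cycles starting with the edge ab,
is at most n²/4 up to an error controlled by triangles. This gives n⁴/8 labelled four-cycles to
leading order. -/

set_option linter.unusedSectionVars false

open Finset

/-- Consecutive vertices of a duplicate-free list, closed up, form a cycle. -/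
theorem cycleGraph_isContained_of_list {V : Type*} {G : SimpleGraph V} (l : List V)
    (hn : l.Nodup) (hc : l.IsChain G.Adj) (h0 : l ≠ [])
    (hlast : G.Adj (l.getLast h0) (l.head h0)) :
    (SimpleGraph.cycleGraph l.length).IsContained G := by
  have hpos : 0 < l.length := List.length_pos_iff.mpr h0
  have key : ∀ u v : Fin l.length, (u - v).val = 1 → G.Adj (l.get u) (l.get v) := by
    intro u v huv
    rcases Nat.lt_or_ge v.val u.val with h | h
    · have h1 : u.val = v.val + 1 := by
        rw [Fin.sub_val_of_le (Fin.le_def.mpr h.le)] at huv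
        omega
      have h2 := List.isChain_iff_getElem.mp hc v.val (by have := u.2; omega)
      have h3 : l.get u = l[v.val + 1]'(by have := u.2; omega) := by
        simp [List.get_eq_getElem, h1]
      rw [h3]
      exact h2.symm
    · have hu := u.2
      have hv := v.2
      -- The difference 1 is taken modulo the length, so here it can only be the closing edge from
      -- the last vertex to the first.
      rw [Fin.val_sub] at huv
      have h1 : v.val = l.length - 1 ∧ u.val = 0 := by
        rcases Nat.lt_or_ge (l.length - v.val + u.val) l.length with h' | h'
        · rw [Nat.mod_eq_of_lt h'] at huv
          omega
        · have : l.length - v.val + u.val = l.length := by omega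
          rw [this] at huv
          simp at huv
      have h2 : l.get u = l.head h0 := by
        rw [List.head_eq_getElem]
        simp [List.get_eq_getElem, h1.2]
      have h3 : l.get v = l.getLast h0 := by
        rw [List.getLast_eq_getElem]
        simp [List.get_eq_getElem, h1.1]
      rw [h2, h3]
      exact hlast.symm
  refine ⟨⟨⟨l.get, ?_⟩, hn.injective_get⟩⟩
  intro u v huv
  rcases SimpleGraph.cycleGraph_adj'.mp huv with h | h
  · exact key u v h
  · exact (key v u h).symm

/-! ### Subgraphs of large minimum degree and greedy paths -/

/-- In the bipartite graph that the relation `R` induces between `A` and `B`, all degrees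
exceed `c`. -/
def MinDegreeGT {V : Type*} (R : V → V → Prop) [DecidableRel R] (c : ℕ) (A B : Finset V) : Prop :=
  (∀ a ∈ A, c < #{b ∈ B | R a b}) ∧ ∀ b ∈ B, c < #{a ∈ A | R b a}

section core

variable {V : Type*} [DecidableEq V] {R : V → V → Prop} [DecidableRel R]

/-- Deleting a vertex of degree at most `c` from either side loses at most `c` pairs, so the strict
inequality persists and the process stops before `A` is exhausted. The sides may overlap. -/
theorem exists_minDegreeGT (hR : ∀ {a b}, R a b → R b a) (c : ℕ) (A B : Finset V)
    (h : c * (#A + #B) < ∑ a ∈ A, #{b ∈ B | R a b}) :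
    ∃ A' ⊆ A, ∃ B' ⊆ B, A'.Nonempty ∧ MinDegreeGT R c A' B' := by
  induction hs : #A + #B generalizing A B with
  | zero =>
    have : A = ∅ := by rw [← card_eq_zero]; omega
    subst this
    simp at h
  | succ s ih =>
    by_cases h1 : ∃ a ∈ A, #{b ∈ B | R a b} ≤ c
    · obtain ⟨a, ha, hac⟩ := h1
      have hcard := card_erase_add_one ha
      obtain ⟨A', hA', B', hB', hh⟩ := ih (A.erase a) B (by
        rw [← add_sum_erase A _ ha] at h
        have : #A + #B = (#(A.erase a) + #B) + 1 := by omega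
        rw [this, mul_add] at h
        omega) (by omega)
      exact ⟨A', hA'.trans (erase_subset _ _), B', hB', hh⟩
    by_cases h2 : ∃ b ∈ B, #{a ∈ A | R b a} ≤ c
    · obtain ⟨b, hb, hbc⟩ := h2
      have hcard := card_erase_add_one hb
      have hsplit : ∑ a ∈ A, #{x ∈ B | R a x}
          = ∑ a ∈ A, #{x ∈ B.erase b | R a x} + #{a ∈ A | R b a} := by
        rw [card_filter, ← sum_add_distrib]
        refine sum_congr rfl fun a _ => ?_
        rw [card_filter, card_filter, ← add_sum_erase B _ hb, add_comm]
        congr 2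
        simp only [eq_iff_iff]
        exact ⟨fun h => hR h, fun h => hR h⟩
      obtain ⟨A', hA', B', hB', hh⟩ := ih A (B.erase b) (by
        have : #A + #B = (#A + #(B.erase b)) + 1 := by omega
        rw [this, mul_add, hsplit] at h
        omega) (by omega)
      exact ⟨A', hA', B', hB'.trans (erase_subset _ _), hh⟩
    push Not at h1 h2
    refine ⟨A, Subset.rfl, B, Subset.rfl, ?_, h1, h2⟩
    rw [nonempty_iff_ne_empty]
    rintro rfl
    simp at h

/-- Greedy extension, two vertices at a time, with both added to the forbidden set `Z`. Since `A`
and `B` may overlap, vertices of both sides must be avoided at every step. -/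
theorem MinDegreeGT.exists_path {c : ℕ} {A B : Finset V} (h : MinDegreeGT R c A B) (t : ℕ) :
    ∀ (a : V) (Z : Finset V), a ∈ A → a ∉ Z → #Z + 2 * t ≤ c →
    ∃ (l : List V) (h0 : a :: l ≠ []), (a :: l).length = 2 * t + 1 ∧ (a :: l).Nodup ∧
      (a :: l).IsChain R ∧ (a :: l).getLast h0 ∈ A ∧
      ∀ x ∈ a :: l, x ∉ Z ∧ (x ∈ A ∨ x ∈ B) := by
  induction t with
  | zero =>
    intro a Z ha haZ _
    exact ⟨[], by simp, by simp, by simp, by simp, by simpa, by simp [ha, haZ]⟩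
  | succ t ih =>
    intro a Z ha haZ hZ
    obtain ⟨b, hb, hbZ⟩ := exists_mem_notMem_of_card_lt_card
      (s := insert a Z) (t := {b ∈ B | R a b})
      (by have := h.1 a ha; have := card_insert_le a Z; omega)
    rw [mem_filter] at hb
    obtain ⟨a', ha', haZ'⟩ := exists_mem_notMem_of_card_lt_card
      (s := insert b (insert a Z)) (t := {x ∈ A | R b x})
      (by
        have := h.2 b hb.1; have := card_insert_le a Z
        have := card_insert_le b (insert a Z); omega)
    rw [mem_filter] at ha'
    obtain ⟨l, h0, hl, hnd, hch, hlast, hmem⟩ := ih a' (insert b (insert a Z)) ha'.1 haZ' (by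
      have := card_insert_le a Z
      have := card_insert_le b (insert a Z); omega)
    simp only [mem_insert, not_or] at hbZ
    have hb' : b ∉ a' :: l := fun hx => (hmem b hx).1 (by simp)
    have haa : a ∉ a' :: l := fun hx => (hmem a hx).1 (by simp)
    refine ⟨b :: a' :: l, by simp, ?_, ?_, ?_, ?_, ?_⟩
    · simp only [List.length_cons] at hl ⊢
      omega
    · refine List.nodup_cons.mpr ⟨?_, List.nodup_cons.mpr ⟨hb', hnd⟩⟩
      rw [List.mem_cons, not_or]
      exact ⟨fun e => hbZ.1 e.symm, haa⟩
    · exact List.isChain_cons_cons.mpr ⟨hb.2, List.isChain_cons_cons.mpr ⟨ha'.2, hch⟩⟩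
    · simpa using hlast
    · intro x hx
      rcases List.mem_cons.mp hx with rfl | hx
      · exact ⟨haZ, Or.inl ha⟩
      rcases List.mem_cons.mp hx with rfl | hx
      · exact ⟨hbZ.2, Or.inr hb.1⟩
      obtain ⟨h1, h2⟩ := hmem x hx
      simp only [mem_insert, not_or] at h1
      exact ⟨h1.2.2, h2⟩

/-- A relation with more than `2 c |S|` related pairs in `S` has a path in `S` on `m` vertices. -/
theorem exists_path_of_lt_sum (hR : ∀ {a b}, R a b → R b a) {c m : ℕ} (hm : 2 * m ≤ c) (S : Finset V)
    (h : 2 * c * #S < ∑ a ∈ S, #{b ∈ S | R a b}) :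
    ∃ l : List V, l.length = m ∧ l.Nodup ∧ l.IsChain R ∧ ∀ x ∈ l, x ∈ S := by
  obtain ⟨A, hA, B, hB, ⟨a, ha⟩, hAB⟩ := exists_minDegreeGT hR c S S (by
    rw [← two_mul, mul_left_comm, ← mul_assoc]; exact h)
  obtain ⟨l, h0, hl, hnd, hch, -, hmem⟩ := hAB.exists_path m a ∅ ha (by simp) (by simpa using hm)
  refine ⟨(a :: l).take m, ?_, hnd.sublist (List.take_sublist _ _), hch.take _, ?_⟩
  · rw [List.length_take, hl]
    omega
  · intro x hx
    rcases (hmem x (List.mem_of_mem_take hx)).2 with h | h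
    · exact hA h
    · exact hB h

end core

/-! ### Edges between breadth-first layers of a C_{2k}-free graph -/

section layers

variable {V : Type*} [DecidableEq V] {G : SimpleGraph V} [DecidableRel G.Adj]

/-- A path on 2k - 1 vertices with both ends in `A` closes through `x`. -/
theorem MinDegreeGT.cycleGraph_isContained {c k : ℕ} (hk : 2 ≤ k) (hc : 2 * k ≤ c)
    {A B : Finset V} (h : MinDegreeGT G.Adj c A B) (hA : A.Nonempty) {x : V}
    (hxA : ∀ a ∈ A, G.Adj x a) (hxB : x ∉ B) :
    (SimpleGraph.cycleGraph (2 * k)).IsContained G := by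
  obtain ⟨a, ha⟩ := hA
  obtain ⟨l, h0, hl, hnd, hch, hlast, hmem⟩ :=
    h.exists_path (k - 1) a ∅ ha (by simp) (by simp; omega)
  have hx : x ∉ a :: l := by
    intro hx
    rcases (hmem x hx).2 with h | h
    · exact G.loopless.irrefl x (hxA x h)
    · exact hxB h
  have := cycleGraph_isContained_of_list (G := G) (x :: a :: l) (List.nodup_cons.mpr ⟨hx, hnd⟩)
    (List.isChain_cons_cons.mpr ⟨hxA a ha, hch⟩) (by simp) (by
      rw [List.getLast_cons h0]
      exact (hxA _ hlast).symm)
  rwa [show (x :: a :: l).length = 2 * k by simp only [List.length_cons] at hl ⊢; omega] at this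

theorem sum_card_le_of_subset_neighbors {c k : ℕ} (hk : 2 ≤ k) (hc : 2 * k ≤ c)
    (hG : (SimpleGraph.cycleGraph (2 * k)).Free G) {A B : Finset V} {x : V}
    (hxA : ∀ a ∈ A, G.Adj x a) (hxB : x ∉ B) :
    ∑ a ∈ A, #{b ∈ B | G.Adj a b} ≤ c * (#A + #B) := by
  by_contra! h
  obtain ⟨A', hA', B', hB', hne, hd⟩ := exists_minDegreeGT (fun h => h.symm) c A B h
  exact hG (hd.cycleGraph_isContained hk hc hne (fun a ha => hxA a (hA' ha))
    (fun hx => hxB (hB' hx)))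

/-- Give each `a ∈ A` a parent in the neighbourhood of `x`. In a subgraph of large minimum degree, a
path on 2k - 3 vertices with ends in `A'` whose parents differ would close through the two parents
and `x`. This forces parents to be constant on the neighbourhood of each `w ∈ B'`, so one parent
class keeps its minimum degree, and its parent can serve as the apex of a 2k-cycle. -/
theorem sum_card_le_of_second_neighbors {c k : ℕ} (hk : 3 ≤ k) (hc : 2 * k ≤ c)
    (hG : (SimpleGraph.cycleGraph (2 * k)).Free G) {A B : Finset V} {x : V}
    (hA : ∀ a ∈ A, a ≠ x ∧ ¬ G.Adj x a ∧ ∃ u, G.Adj x u ∧ G.Adj u a)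
    (hB : ∀ b ∈ B, b ≠ x ∧ ¬ G.Adj x b) :
    ∑ a ∈ A, #{b ∈ B | G.Adj a b} ≤ c * (#A + #B) := by
  by_contra! h
  obtain ⟨A', hA', B', hB', ⟨a₀, ha₀⟩, hd⟩ := exists_minDegreeGT (fun h => h.symm) c A B h
  have hpar : ∀ a : V, ∃ u, a ∈ A → G.Adj x u ∧ G.Adj u a := by
    intro a
    by_cases ha : a ∈ A
    · obtain ⟨u, hu⟩ := (hA a ha).2.2
      exact ⟨u, fun _ => hu⟩
    · exact ⟨x, fun h => absurd h ha⟩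
  choose f hf using hpar
  have hmemx : ∀ v, v ∈ A' ∨ v ∈ B' → v ≠ x ∧ ¬ G.Adj x v := by
    rintro v (hv | hv)
    · exact ⟨(hA v (hA' hv)).1, (hA v (hA' hv)).2.1⟩
    · exact hB v (hB' hv)
  -- the ends of a path on `2 * k - 3` vertices have the same parent
  have hends : ∀ (y : V) (l : List V), (y :: l).length = 2 * k - 3 → (y :: l).Nodup →
      (y :: l).IsChain G.Adj → (∀ v ∈ y :: l, v ∈ A' ∨ v ∈ B') → y ∈ A' →
      ∀ h0 : y :: l ≠ [], (y :: l).getLast h0 ∈ A' → f y = f ((y :: l).getLast h0) := by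
    intro y l hl hnd hch hmem hy h0 hlast
    by_contra hne
    set z := (y :: l).getLast h0 with hz
    have hfy := hf y (hA' hy)
    have hfz := hf z (hA' hlast)
    have hnot : ∀ u, G.Adj x u → u ∉ y :: l := fun u hu hmu => (hmemx u (hmem u hmu)).2 hu
    have hxl : x ∉ y :: l := fun hmu => (hmemx x (hmem x hmu)).1 rfl
    refine hG ?_
    have := cycleGraph_isContained_of_list (G := G) (f z :: x :: f y :: y :: l)
      (by
        refine List.nodup_cons.mpr ⟨?_, List.nodup_cons.mpr ⟨?_, List.nodup_cons.mpr
          ⟨hnot _ hfy.1, hnd⟩⟩⟩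
        · rw [List.mem_cons, List.mem_cons, not_or, not_or]
          exact ⟨hfz.1.ne', Ne.symm hne, hnot _ hfz.1⟩
        · rw [List.mem_cons, not_or]
          exact ⟨hfy.1.ne, hxl⟩)
      (List.isChain_cons_cons.mpr ⟨hfz.1.symm, List.isChain_cons_cons.mpr ⟨hfy.1,
        List.isChain_cons_cons.mpr ⟨hfy.2, hch⟩⟩⟩) (by simp) (by
        rw [List.getLast_cons (by simp), List.getLast_cons (by simp), List.getLast_cons h0]
        exact hfz.2.symm)
    rwa [show (f z :: x :: f y :: y :: l).length = 2 * k by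
      simp only [List.length_cons] at hl ⊢; omega] at this
  -- One path on 2k - 5 vertices, starting at a third neighbour `y` of `w`, is prolonged through `w`
  -- to `y₁` or to `y₂`; both prolongations have 2k - 3 vertices and the same far end.
  have hmono : ∀ w ∈ B', ∀ y₁ ∈ A', ∀ y₂ ∈ A', G.Adj w y₁ → G.Adj w y₂ → f y₁ = f y₂ := by
    intro w hw y₁ hy₁ y₂ hy₂ h₁ h₂
    obtain ⟨y, hy, hyn⟩ := exists_mem_notMem_of_card_lt_card
      (s := {y₁, y₂, w}) (t := {a ∈ A' | G.Adj w a})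
      (by have := hd.2 w hw; have := card_le_three (a := y₁) (b := y₂) (c := w); omega)
    rw [mem_filter] at hy
    obtain ⟨l, h0, hl, hnd, hch, hlast, hmem⟩ := hd.exists_path (k - 3) y {y₁, y₂, w} hy.1 hyn
      (by have := card_le_three (a := y₁) (b := y₂) (c := w); omega)
    have aux : ∀ y' ∈ A', G.Adj w y' → y' ∉ y :: l → f y' = f ((y :: l).getLast h0) := by
      intro y' hy' hwy' hyl
      have hwl : w ∉ y :: l := fun hx => (hmem w hx).1 (by simp)
      have := hends y' (w :: y :: l) (by simp only [List.length_cons] at hl ⊢; omega)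
        (by
          refine List.nodup_cons.mpr ⟨?_, List.nodup_cons.mpr ⟨hwl, hnd⟩⟩
          rw [List.mem_cons, not_or]
          exact ⟨hwy'.ne', hyl⟩)
        (List.isChain_cons_cons.mpr ⟨hwy'.symm, List.isChain_cons_cons.mpr ⟨hy.2, hch⟩⟩)
        (by
          intro v hv
          rcases List.mem_cons.mp hv with rfl | hv
          · exact Or.inl hy'
          rcases List.mem_cons.mp hv with rfl | hv
          · exact Or.inr hw
          exact (hmem v hv).2)
        hy' (by simp) (by
          rw [List.getLast_cons (by simp), List.getLast_cons h0]; exact hlast)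
      rwa [List.getLast_cons (by simp), List.getLast_cons h0] at this
    rw [aux y₁ hy₁ h₁ fun hx => (hmem _ hx).1 (by simp),
      aux y₂ hy₂ h₂ fun hx => (hmem _ hx).1 (by simp)]
  -- restrict to the vertices with the same parent as `a₀`
  set A₁ := {a ∈ A' | f a = f a₀} with hA₁
  set B₁ := {b ∈ B' | ∃ a ∈ A₁, G.Adj a b} with hB₁
  have hd₁ : MinDegreeGT G.Adj c A₁ B₁ := by
    constructor
    · intro a ha
      refine (hd.1 a (mem_filter.mp ha).1).trans_le (card_le_card fun b hb => ?_)
      rw [mem_filter] at hb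
      exact mem_filter.mpr ⟨mem_filter.mpr ⟨hb.1, a, ha, hb.2⟩, hb.2⟩
    · intro b hb
      obtain ⟨hbB, a, ha, hab⟩ := mem_filter.mp hb
      obtain ⟨haA, haf⟩ := mem_filter.mp ha
      refine (hd.2 b hbB).trans_le (card_le_card fun a' ha' => ?_)
      rw [mem_filter] at ha'
      refine mem_filter.mpr ⟨mem_filter.mpr ⟨ha'.1, ?_⟩, ha'.2⟩
      rw [← haf]
      exact hmono b hbB a' ha'.1 a haA ha'.2 hab.symm
  refine hG (hd₁.cycleGraph_isContained (by omega) hc ⟨a₀, mem_filter.mpr ⟨ha₀, rfl⟩⟩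
    (x := f a₀) ?_ ?_)
  · intro a ha
    obtain ⟨haA, haf⟩ := mem_filter.mp ha
    rw [← haf]
    exact (hf a (hA' haA)).2
  · intro hx
    exact (hB _ (hB' (mem_filter.mp hx).1)).2 (hf a₀ (hA' ha₀)).1

end layers

/-! ### Labelled copies, unlabelled copies and automorphisms -/

section counting

variable {V W : Type*}

/-- Embeddings with the same image subgraph differ by a unique automorphism of `H`, so each fibre of
`toSubgraph` has as many elements as the automorphism group. -/
theorem natCard_copy_eq_copyCount_mul [Fintype V] [Fintype W] (G : SimpleGraph V)
    (H : SimpleGraph W) :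
    Nat.card (H.Copy G) = G.copyCount H * Nat.card (H ≃g H) := by
  classical
  have hfin : Finite (H ≃g H) := Finite.of_injective (fun e => (e : W → W)) DFunLike.coe_injective
  have := Fintype.ofFinite (H ≃g H)
  rw [Nat.card_eq_fintype_card, SimpleGraph.copyCount_eq_card_image_copyToSubgraph,
    ← Finset.card_univ, Nat.card_eq_fintype_card,
    card_eq_sum_card_image (SimpleGraph.Copy.toSubgraph (A := H) (B := G))]
  refine sum_const_nat fun G' hG' => ?_
  obtain ⟨g, -, hg⟩ := mem_image.mp hG'
  subst hg
  rw [← Finset.card_univ]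
  symm
  refine card_bij (fun σ _ => g.comp σ.toCopy) ?_ ?_ ?_
  · intro σ _
    rw [mem_filter]
    refine ⟨mem_univ _, ?_⟩
    ext a b
    · simp only [SimpleGraph.Copy.toSubgraph, SimpleGraph.Subgraph.map_verts,
        SimpleGraph.Subgraph.verts_top, Set.image_univ, Set.mem_range]
      constructor
      · rintro ⟨y, hy⟩
        exact ⟨σ y, hy⟩
      · rintro ⟨y, hy⟩
        exact ⟨σ.symm y, by simpa using hy⟩
    · simp only [SimpleGraph.Copy.toSubgraph, SimpleGraph.Subgraph.map_adj, Relation.Map,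
        SimpleGraph.Subgraph.top_adj]
      constructor
      · rintro ⟨x, y, hxy, hx, hy⟩
        exact ⟨σ x, σ y, σ.map_rel_iff.mpr hxy, hx, hy⟩
      · rintro ⟨x, y, hxy, hx, hy⟩
        exact ⟨σ.symm x, σ.symm y, σ.symm.map_rel_iff.mpr hxy, by simpa using hx,
          by simpa using hy⟩
  · intro σ _ τ _ h
    ext w
    have := DFunLike.congr_fun h w
    exact g.injective this
  · intro f hf
    rw [mem_filter] at hf
    have hsub := hf.2
    -- Turns the equality of image subgraphs into an isomorphism that fixes the underlying vertices,
    -- avoiding dependent casts.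
    have hcast : ∀ G₁ G₂ : G.Subgraph, G₁ = G₂ →
        ∃ e : G₁.coe ≃g G₂.coe, ∀ x, ((e x : G₂.verts) : V) = x := by
      rintro G₁ _ rfl
      exact ⟨SimpleGraph.Iso.refl, fun _ => rfl⟩
    obtain ⟨e, he⟩ := hcast _ _ hsub
    refine ⟨f.isoToSubgraph.trans (e.trans g.isoToSubgraph.symm), mem_univ _, ?_⟩
    ext w
    have h1 : ∀ y, ((g.isoToSubgraph y : g.toSubgraph.verts) : V) = g y := fun _ => rfl
    have h2 : ∀ y, ((f.isoToSubgraph y : f.toSubgraph.verts) : V) = f y := fun _ => rfl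
    change g (g.isoToSubgraph.symm (e (f.isoToSubgraph w))) = f w
    rw [← h1, RelIso.apply_symm_apply, he, h2]

end counting

theorem natCard_cycleGraph_four_iso :
    Nat.card (SimpleGraph.cycleGraph 4 ≃g SimpleGraph.cycleGraph 4) = 8 := by
  have e : (SimpleGraph.cycleGraph 4 ≃g SimpleGraph.cycleGraph 4) ≃
      {σ : Equiv.Perm (Fin 4) // ∀ a b, (SimpleGraph.cycleGraph 4).Adj (σ a) (σ b) ↔
        (SimpleGraph.cycleGraph 4).Adj a b} :=
    { toFun := fun e => ⟨e.toEquiv, fun a b => e.map_rel_iff⟩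
      invFun := fun σ => ⟨σ.1, fun {a b} => σ.2 a b⟩
      left_inv := fun _ => rfl
      right_inv := fun _ => rfl }
  rw [Nat.card_congr e, Nat.card_eq_fintype_card]
  decide +kernel

/-! ### Labelled four-cycles and fibrewise counting -/

section

variable {V : Type*}

/-- `(a, b, c, d)` are the consecutive vertices of a four-cycle. -/
def IsFourCycle (G : SimpleGraph V) (q : V × V × V × V) : Prop :=
  G.Adj q.1 q.2.1 ∧ G.Adj q.2.1 q.2.2.1 ∧ G.Adj q.2.2.1 q.2.2.2 ∧ G.Adj q.2.2.2 q.1 ∧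
    q.1 ≠ q.2.2.1 ∧ q.2.1 ≠ q.2.2.2

open Classical in
/-- The labelled four-cycles that satisfy `P`. -/
noncomputable def fourCycles [Fintype V] (G : SimpleGraph V) (P : V × V × V × V → Prop) :
    Finset (V × V × V × V) :=
  {q | IsFourCycle G q ∧ P q}

theorem mem_fourCycles [Fintype V] {G : SimpleGraph V} {P : V × V × V × V → Prop}
    {q : V × V × V × V} : q ∈ fourCycles G P ↔ IsFourCycle G q ∧ P q := by
  classical
  simp [fourCycles]

/-- The number of labelled four-cycles that satisfy `P`. -/
noncomputable def fourCycleCount [Fintype V] (G : SimpleGraph V) (P : V × V × V × V → Prop) : ℕ :=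
  #(fourCycles G P)

theorem natCard_eq_card_of_bij {α β : Type*} {S : Finset β} (i : α → β)
    (hi : ∀ a, i a ∈ S) (hinj : Function.Injective i) (hsurj : ∀ b ∈ S, ∃ a, i a = b) :
    Nat.card α = #S := by
  rw [← Nat.card_eq_finsetCard]
  exact Nat.card_congr (Equiv.ofBijective (fun a => (⟨i a, hi a⟩ : S))
    ⟨fun a b h => hinj (congrArg Subtype.val h), fun b => (hsurj b b.2).imp fun a h => Subtype.ext h⟩)

theorem fourCycleCount_eq [Fintype V] (G : SimpleGraph V) :
    fourCycleCount G (fun _ => True) = 8 * G.copyCount (SimpleGraph.cycleGraph 4) := by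
  classical
  have hlab := natCard_copy_eq_copyCount_mul G (SimpleGraph.cycleGraph 4)
  rw [natCard_cycleGraph_four_iso, mul_comm] at hlab
  rw [← hlab]
  unfold fourCycleCount
  symm
  refine natCard_eq_card_of_bij (fun f => (f 0, f 1, f 2, f 3)) ?_ ?_ ?_
  · intro f
    rw [mem_fourCycles]
    have hi : ∀ i j : Fin 4, i ≠ j → f i ≠ f j := fun i j h h' => h (f.injective h')
    exact ⟨⟨f.toHom.map_adj (by decide), f.toHom.map_adj (by decide),
      f.toHom.map_adj (by decide), f.toHom.map_adj (by decide), hi 0 2 (by decide),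
      hi 1 3 (by decide)⟩, trivial⟩
  · intro f g h
    simp only [Prod.mk.injEq] at h
    ext i
    fin_cases i
    exacts [h.1, h.2.1, h.2.2.1, h.2.2.2]
  · rintro ⟨a, b, c, d⟩ hq
    obtain ⟨h1, h2, h3, h4, h5, h6⟩ := (mem_fourCycles.mp hq).1
    simp only at h1 h2 h3 h4 h5 h6
    refine ⟨⟨⟨![a, b, c, d], ?_⟩, ?_⟩, rfl⟩
    · intro i j hij
      fin_cases i <;> fin_cases j <;>
        first
        | exact absurd hij (by decide)
        | exact h1
        | exact h1.symm
        | exact h2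
        | exact h2.symm
        | exact h3
        | exact h3.symm
        | exact h4
        | exact h4.symm
    · intro i j hij
      fin_cases i <;> fin_cases j <;>
        first
        | rfl
        | exact absurd hij h1.ne
        | exact absurd hij h1.ne'
        | exact absurd hij h2.ne
        | exact absurd hij h2.ne'
        | exact absurd hij h3.ne
        | exact absurd hij h3.ne'
        | exact absurd hij h4.ne
        | exact absurd hij h4.ne'
        | exact absurd hij h5
        | exact absurd hij h5.symm
        | exact absurd hij h6
        | exact absurd hij h6.symm

/-- Transfers a bound proved for one position on the cycle to the other positions. -/
theorem fourCycleCount_rotate [Fintype V] (G : SimpleGraph V) (P : V × V × V × V → Prop) :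
    fourCycleCount G P = fourCycleCount G (fun q => P (q.2.1, q.2.2.1, q.2.2.2, q.1)) := by
  classical
  symm
  refine card_bij (fun q _ => (q.2.1, q.2.2.1, q.2.2.2, q.1)) ?_ ?_ ?_
  · rintro ⟨a, b, c, d⟩ hq
    obtain ⟨⟨h1, h2, h3, h4, h5, h6⟩, h⟩ := mem_fourCycles.mp hq
    exact mem_fourCycles.mpr ⟨⟨h2, h3, h4, h1, h6, h5.symm⟩, h⟩
  · rintro ⟨a, b, c, d⟩ _ ⟨a', b', c', d'⟩ _ h
    simp only [Prod.mk.injEq] at h ⊢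
    tauto
  · rintro ⟨a, b, c, d⟩ hq
    obtain ⟨⟨h1, h2, h3, h4, h5, h6⟩, h⟩ := mem_fourCycles.mp hq
    exact ⟨(d, a, b, c), mem_fourCycles.mpr ⟨⟨h4, h1, h2, h3, h6.symm, h5⟩, h⟩, rfl⟩

theorem fourCycleCount_le_add [Fintype V] {G : SimpleGraph V} {R P Q : V × V × V × V → Prop}
    (hR : ∀ q, IsFourCycle G q → R q → P q ∨ Q q) :
    fourCycleCount G R ≤ fourCycleCount G P + fourCycleCount G Q := by
  classical
  refine le_trans (card_le_card fun q hq => ?_) (card_union_le _ _)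
  obtain ⟨h1, h⟩ := mem_fourCycles.mp hq
  rcases hR q h1 h with h | h
  · exact mem_union_left _ (mem_fourCycles.mpr ⟨h1, h⟩)
  · exact mem_union_right _ (mem_fourCycles.mpr ⟨h1, h⟩)

/-- Counting four-cycles along a map whose fibres are bounded. -/
theorem fourCycleCount_le_sum [Fintype V] {β : Type*} [DecidableEq β] {G : SimpleGraph V}
    {P : V × V × V × V → Prop} (π : V × V × V × V → β) (T : Finset β) (m : β → ℕ)
    (hT : ∀ q, IsFourCycle G q → P q → π q ∈ T)
    (hm : ∀ t ∈ T, fourCycleCount G (fun q => P q ∧ π q = t) ≤ m t) :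
    fourCycleCount G P ≤ ∑ t ∈ T, m t := by
  classical
  rw [fourCycleCount, card_eq_sum_card_fiberwise (f := π) (t := T) fun q hq => by
    have := mem_fourCycles.mp hq
    exact hT q this.1 this.2]
  refine sum_le_sum fun t ht => le_trans (le_of_eq ?_) (hm t ht)
  rw [fourCycleCount]
  congr 1
  ext q
  simp only [mem_filter, mem_fourCycles, and_assoc]

/-- A bound for a set of four-cycles that are determined by their image in a finite set. -/
theorem fourCycleCount_le_card [Fintype V] {β : Type*} {G : SimpleGraph V}
    {P : V × V × V × V → Prop} (φ : V × V × V × V → β) (T : Finset β)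
    (hT : ∀ q, IsFourCycle G q → P q → φ q ∈ T)
    (hinj : ∀ q q', P q → P q' → φ q = φ q' → q = q') :
    fourCycleCount G P ≤ #T := by
  classical
  refine card_le_card_of_injOn φ (fun q hq => ?_) fun q hq q' hq' h => ?_
  · have := mem_fourCycles.mp hq
    exact hT q this.1 this.2
  · exact hinj q q' (mem_fourCycles.mp hq).2 (mem_fourCycles.mp hq').2 h

end

/-! ### Degree sums and walks of length three -/

section degrees

variable {V : Type*} [Fintype V] [DecidableEq V] {G : SimpleGraph V} [DecidableRel G.Adj]

/-- The vertices that are joined to `x` by a walk of length two. -/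
def twoStep (G : SimpleGraph V) [DecidableRel G.Adj] (x : V) : Finset V :=
  {w | ∃ u, G.Adj x u ∧ G.Adj u w}

theorem mem_twoStep {x w : V} : w ∈ twoStep G x ↔ ∃ u, G.Adj x u ∧ G.Adj u w := by
  simp [twoStep]

theorem mem_twoStep_comm {x w : V} : w ∈ twoStep G x ↔ x ∈ twoStep G w := by
  simp only [mem_twoStep]
  exact ⟨fun ⟨u, h⟩ => ⟨u, h.2.symm, h.1.symm⟩, fun ⟨u, h⟩ => ⟨u, h.2.symm, h.1.symm⟩⟩

theorem sum_sum_comm_of_symm {M : Type*} [AddCommMonoid M] {S : V → Finset V}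
    (hS : ∀ x y, y ∈ S x ↔ x ∈ S y) (f : V → V → M) :
    ∑ x, ∑ y ∈ S x, f x y = ∑ y, ∑ x ∈ S y, f x y :=
  sum_comm' (by simpa using hS)

theorem mem_neighborFinset_comm (x y : V) :
    y ∈ G.neighborFinset x ↔ x ∈ G.neighborFinset y := by
  simp [G.adj_comm]

theorem sum_sum_degree_neighbor (G : SimpleGraph V) [DecidableRel G.Adj] :
    ∑ x, ∑ u ∈ G.neighborFinset x, G.degree u = ∑ x, G.degree x ^ 2 := by
  rw [sum_sum_comm_of_symm mem_neighborFinset_comm]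
  refine sum_congr rfl fun x _ => ?_
  rw [sum_const, G.card_neighborFinset_eq_degree, smul_eq_mul, sq]

variable {c k : ℕ}

/-- Apart from the edge back to `x`, every edge at a neighbour of `x` ends in `twoStep G x`, so the
layer bound applies. The size of `twoStep G x` is kept, not replaced by n, because the walk count
weights it by `G.degree x` and then exchanges the two ends. -/
theorem sum_degree_neighbor_le (hk : 2 ≤ k) (hc : 2 * k ≤ c)
    (hG : (SimpleGraph.cycleGraph (2 * k)).Free G) (x : V) :
    ∑ u ∈ G.neighborFinset x, G.degree u
      ≤ G.degree x + c * (G.degree x + #(twoStep G x)) := by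
  have h1 : ∀ u ∈ G.neighborFinset x,
      G.degree u ≤ 1 + #{b ∈ (twoStep G x).erase x | G.Adj u b} := by
    intro u hu
    rw [← G.card_neighborFinset_eq_degree, add_comm]
    refine le_trans (card_le_card (t := insert x {b ∈ (twoStep G x).erase x | G.Adj u b}) ?_)
      (card_insert_le _ _)
    intro w hw
    rw [SimpleGraph.mem_neighborFinset] at hu hw
    by_cases hwx : w = x
    · simp [hwx]
    · simp only [mem_insert, mem_filter, mem_erase, mem_twoStep]
      exact Or.inr ⟨⟨hwx, u, hu, hw⟩, hw⟩
  refine (sum_le_sum h1).trans ?_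
  rw [sum_add_distrib, sum_const, smul_eq_mul, mul_one, G.card_neighborFinset_eq_degree]
  have h2 := sum_card_le_of_subset_neighbors hk hc hG (A := G.neighborFinset x)
    (B := (twoStep G x).erase x) (x := x) (by simp) (by simp)
  rw [G.card_neighborFinset_eq_degree] at h2
  have h3 : c * (G.degree x + #((twoStep G x).erase x)) ≤ c * (G.degree x + #(twoStep G x)) :=
    Nat.mul_le_mul_left _ (Nat.add_le_add_left (card_le_card (erase_subset _ _)) _)
  omega

theorem degree_le_card (v : V) : G.degree v ≤ Fintype.card V := by
  rw [← G.card_neighborFinset_eq_degree]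
  exact card_le_univ _

theorem sum_degree_neighbor_le_card (hk : 2 ≤ k) (hc : 2 * k ≤ c)
    (hG : (SimpleGraph.cycleGraph (2 * k)).Free G) (x : V) :
    ∑ u ∈ G.neighborFinset x, G.degree u ≤ (1 + 2 * c) * Fintype.card V := by
  have h1 := sum_degree_neighbor_le hk hc hG x
  have h2 := degree_le_card (G := G) x
  have h3 : #(twoStep G x) ≤ Fintype.card V := card_le_univ _
  nlinarith [Nat.mul_le_mul_left c h2, Nat.mul_le_mul_left c h3]

theorem sum_degree_sq_le (hk : 2 ≤ k) (hc : 2 * k ≤ c)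
    (hG : (SimpleGraph.cycleGraph (2 * k)).Free G) :
    ∑ x, G.degree x ^ 2 ≤ (1 + 2 * c) * Fintype.card V ^ 2 := by
  rw [← sum_sum_degree_neighbor]
  refine (sum_le_sum fun x _ => sum_degree_neighbor_le_card hk hc hG x).trans (le_of_eq ?_)
  rw [sum_const, smul_eq_mul, card_univ]
  ring

/-- The edges at a vertex of `A` go either to neighbours of `x` or to vertices outside the closed
neighbourhood; the two layer bounds make each kind linear in number. The vertex `x` and its
neighbours are accounted for separately. -/
theorem sum_degree_twoStep_le (hk : 3 ≤ k) (hc : 2 * k ≤ c)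
    (hG : (SimpleGraph.cycleGraph (2 * k)).Free G) (x : V) :
    ∑ y ∈ twoStep G x, G.degree y ≤ (2 + 6 * c) * Fintype.card V := by
  set n := Fintype.card V
  set A : Finset V := {y ∈ twoStep G x | y ≠ x ∧ ¬ G.Adj x y} with hA
  set B : Finset V := {y | y ≠ x ∧ ¬ G.Adj x y} with hB
  have hAx : ∀ a ∈ A, a ≠ x ∧ ¬ G.Adj x a ∧ ∃ u, G.Adj x u ∧ G.Adj u a := by
    intro a ha
    rw [hA, mem_filter, mem_twoStep] at ha
    exact ⟨ha.2.1, ha.2.2, ha.1⟩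
  have hsub : twoStep G x ⊆ {x} ∪ (G.neighborFinset x ∪ A) := by
    intro y hy
    by_cases h1 : y = x
    · simp [h1]
    by_cases h2 : G.Adj x y
    · simp [h2]
    · simp [hA, h1, h2, hy]
  have hu : ∀ S T : Finset V, ∑ y ∈ S ∪ T, G.degree y
      ≤ ∑ y ∈ S, G.degree y + ∑ y ∈ T, G.degree y := by
    intro S T
    rw [← sum_union_inter]
    exact Nat.le_add_right _ _
  have hAsum : ∑ y ∈ A, G.degree y ≤ 4 * c * n := by
    have h1 : ∀ y ∈ A, G.degree y
        ≤ #{u ∈ G.neighborFinset x | G.Adj y u} + #{b ∈ B | G.Adj y b} := by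
      intro y hy
      rw [← G.card_neighborFinset_eq_degree]
      refine (card_le_card fun w hw => ?_).trans (card_union_le _ _)
      rw [SimpleGraph.mem_neighborFinset] at hw
      have hwx : w ≠ x := by
        rintro rfl
        exact (hAx y hy).2.1 hw.symm
      by_cases hxw : G.Adj x w
      · simp [hw, hxw]
      · simp [hB, hw, hxw, hwx]
    refine (sum_le_sum h1).trans ?_
    rw [sum_add_distrib]
    have hn1 : #A ≤ n := card_le_univ _
    have hn2 : #B ≤ n := card_le_univ _
    have hn3 : #(G.neighborFinset x) ≤ n := card_le_univ _
    have h2 : ∑ y ∈ A, #{u ∈ G.neighborFinset x | G.Adj y u}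
        ≤ c * (#(G.neighborFinset x) + #A) := by
      refine le_trans (le_of_eq ?_) (sum_card_le_of_subset_neighbors (by omega) hc hG
        (A := G.neighborFinset x) (B := A) (x := x) (by simp) fun hx => (hAx x hx).1 rfl)
      simp only [card_filter]
      rw [sum_comm]
      simp only [G.adj_comm]
    have h3 : ∑ y ∈ A, #{b ∈ B | G.Adj y b} ≤ c * (#A + #B) :=
      sum_card_le_of_second_neighbors hk hc hG hAx fun b hb => (mem_filter.mp hb).2
    nlinarith [Nat.mul_le_mul_left c hn1, Nat.mul_le_mul_left c hn2, Nat.mul_le_mul_left c hn3]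
  have h1 := sum_degree_neighbor_le_card (by omega) hc hG x
  have h2 := degree_le_card (G := G) x
  calc ∑ y ∈ twoStep G x, G.degree y
      ≤ ∑ y ∈ {x} ∪ (G.neighborFinset x ∪ A), G.degree y := sum_le_sum_of_subset hsub
    _ ≤ G.degree x + (∑ y ∈ G.neighborFinset x, G.degree y + ∑ y ∈ A, G.degree y) := by
        refine (hu _ _).trans ?_
        rw [sum_singleton]
        exact Nat.add_le_add_left (hu _ _) _
    _ ≤ (2 + 6 * c) * n := by nlinarith

/-- A graph without cycles of length `2 k ≥ 6` has `O(n ^ 2)` walks of length three. -/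
theorem sum_degree_mul_degree_le (hk : 3 ≤ k) (hc : 2 * k ≤ c)
    (hG : (SimpleGraph.cycleGraph (2 * k)).Free G) :
    ∑ x, ∑ u ∈ G.neighborFinset x, G.degree x * G.degree u
      ≤ ((1 + c) * (1 + 2 * c) + c * (2 + 6 * c)) * Fintype.card V ^ 2 := by
  set n := Fintype.card V with hn
  have h1 : ∀ x, ∑ u ∈ G.neighborFinset x, G.degree x * G.degree u
      ≤ (1 + c) * G.degree x ^ 2 + c * ∑ y ∈ twoStep G x, G.degree x := by
    intro x
    rw [← mul_sum, sum_const, smul_eq_mul]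
    have := Nat.mul_le_mul_left (G.degree x) (sum_degree_neighbor_le (by omega) hc hG x)
    nlinarith
  have h2 : ∑ x, ∑ y ∈ twoStep G x, G.degree x ≤ (2 + 6 * c) * n ^ 2 := by
    rw [sum_sum_comm_of_symm fun x y => mem_twoStep_comm]
    refine (sum_le_sum fun y _ => sum_degree_twoStep_le hk hc hG y).trans (le_of_eq ?_)
    rw [sum_const, smul_eq_mul, card_univ]
    ring
  have h3 := sum_degree_sq_le (by omega) hc hG
  refine (sum_le_sum fun x _ => h1 x).trans ?_
  rw [sum_add_distrib, ← mul_sum, ← mul_sum]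
  calc _ ≤ (1 + c) * ((1 + 2 * c) * n ^ 2) + c * ((2 + 6 * c) * n ^ 2) :=
        Nat.add_le_add (Nat.mul_le_mul_left _ h3) (Nat.mul_le_mul_left _ h2)
    _ = _ := by ring

/-- Split the neighbours `u` of a low vertex `v` at degree `M`. If `u` has degree at least `M`, then
`M * G.degree v` is absorbed by the walk count; otherwise it is at most `M * D`, and at most M · n
ordered adjacent pairs have such a `u`. -/
theorem mul_sum_degree_sq_le (G : SimpleGraph V) [DecidableRel G.Adj] (D M : ℕ) :
    M * ∑ v with G.degree v < D, G.degree v ^ 2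
      ≤ ∑ x, ∑ u ∈ G.neighborFinset x, G.degree x * G.degree u
        + M ^ 2 * D * Fintype.card V := by
  have h1 : ∀ v ∈ ({v | G.degree v < D} : Finset V), M * G.degree v ^ 2
      ≤ ∑ u ∈ G.neighborFinset v, (G.degree v * G.degree u
        + if G.degree u < M then M * D else 0) := by
    intro v hv
    have hv' := (mem_filter.mp hv).2
    have : M * G.degree v ^ 2 = ∑ u ∈ G.neighborFinset v, M * G.degree v := by
      rw [sum_const, G.card_neighborFinset_eq_degree, smul_eq_mul]
      ring
    rw [this]
    refine sum_le_sum fun u _ => ?_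
    split_ifs with h
    · nlinarith
    · push Not at h
      nlinarith
  rw [mul_sum]
  refine (sum_le_sum h1).trans ((sum_le_sum_of_subset (subset_univ _)).trans ?_)
  simp_rw [sum_add_distrib]
  refine Nat.add_le_add_left ?_ _
  rw [sum_sum_comm_of_symm mem_neighborFinset_comm]
  calc ∑ y, ∑ x ∈ G.neighborFinset y, (if G.degree y < M then M * D else 0)
      ≤ ∑ y : V, M ^ 2 * D := by
        refine sum_le_sum fun y _ => ?_
        rw [sum_const, G.card_neighborFinset_eq_degree, smul_eq_mul]
        split_ifs with h
        · nlinarith [Nat.mul_le_mul_right (M * D) h.le]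
        · simp
    _ = M ^ 2 * D * Fintype.card V := by
        rw [sum_const, card_univ, smul_eq_mul]
        ring

end degrees

/-! ### Pairs of large codegree and vertices with many high neighbours -/

section fat

variable {V : Type*} [Fintype V] [DecidableEq V] {G : SimpleGraph V} [DecidableRel G.Adj]

/-- The common neighbours of two vertices. -/
def commonNbrs (G : SimpleGraph V) [DecidableRel G.Adj] (a c : V) : Finset V :=
  {v | G.Adj a v ∧ G.Adj c v}

theorem mem_commonNbrs {a c v : V} : v ∈ commonNbrs G a c ↔ G.Adj a v ∧ G.Adj c v := by
  simp [commonNbrs]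

theorem commonNbrs_comm (a c : V) : commonNbrs G a c = commonNbrs G c a := by
  ext v
  simp only [mem_commonNbrs, and_comm]

/-- Two distinct vertices with at least `K` common neighbours. -/
def FatPair (G : SimpleGraph V) [DecidableRel G.Adj] (K : ℕ) (a c : V) : Prop :=
  a ≠ c ∧ K ≤ #(commonNbrs G a c)

instance (K : ℕ) : DecidableRel (FatPair G K) := fun _ _ => inferInstanceAs (Decidable (_ ∧ _))

theorem FatPair.symm {K : ℕ} {a c : V} (h : FatPair G K a c) : FatPair G K c a :=
  ⟨h.1.symm, commonNbrs_comm (G := G) a c ▸ h.2⟩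

/-- A path of fat pairs can be subdivided into a path of the graph. -/
theorem exists_subdivision {K : ℕ} (l : List V) : ∀ (y : V) (Z : Finset V), (y :: l).Nodup →
    (y :: l).IsChain (FatPair G K) → (∀ x ∈ y :: l, x ∈ Z) → #Z + l.length ≤ K →
    ∃ l' : List V, (y :: l').Nodup ∧ (y :: l').IsChain G.Adj ∧ l'.length = 2 * l.length ∧
      (y :: l').getLast (by simp) = (y :: l).getLast (by simp) ∧
      ∀ x ∈ y :: l', x ∈ y :: l ∨ x ∉ Z := by
  induction l with
  | nil =>
    intro y Z _ _ _ _
    exact ⟨[], by simp, by simp, rfl, rfl, fun x hx => Or.inl hx⟩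
  | cons z l ih =>
    intro y Z hnd hch hmem hZ
    rw [List.length_cons] at hZ
    rw [List.isChain_cons_cons] at hch
    rw [List.nodup_cons] at hnd
    obtain ⟨p, hp, hpZ⟩ := exists_mem_notMem_of_card_lt_card (s := Z) (t := commonNbrs G y z)
      (by have := hch.1.2; omega)
    rw [mem_commonNbrs] at hp
    obtain ⟨l', h1, h2, h3, h4, h5⟩ := ih z (insert p Z) hnd.2 hch.2
      (fun x hx => mem_insert_of_mem (hmem x (List.mem_cons_of_mem _ hx)))
      (by have := card_insert_le p Z; omega)
    have hyZ : y ∈ Z := hmem y (by simp)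
    have hpl : p ∉ z :: l' := by
      intro h
      rcases h5 p h with h | h
      · exact hpZ (hmem p (List.mem_cons_of_mem _ h))
      · exact h (mem_insert_self _ _)
    have hyl : y ∉ z :: l' := by
      intro h
      rcases h5 y h with h | h
      · exact hnd.1 h
      · exact h (mem_insert_of_mem hyZ)
    refine ⟨p :: z :: l', ?_, ?_, ?_, ?_, ?_⟩
    · refine List.nodup_cons.mpr ⟨?_, List.nodup_cons.mpr ⟨hpl, h1⟩⟩
      rw [List.mem_cons, not_or]
      exact ⟨fun h => hpZ (h ▸ hyZ), hyl⟩
    · exact List.isChain_cons_cons.mpr ⟨hp.1, List.isChain_cons_cons.mpr ⟨hp.2.symm, h2⟩⟩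
    · simp only [List.length_cons, h3]
      ring
    · exact (List.getLast_cons (by simp)).trans ((List.getLast_cons (by simp)).trans
        (h4.trans (List.getLast_cons (by simp)).symm))
    · intro x hx
      rcases List.mem_cons.mp hx with rfl | hx
      · exact Or.inl (by simp)
      rcases List.mem_cons.mp hx with rfl | hx
      · exact Or.inr hpZ
      rcases h5 x hx with h | h
      · exact Or.inl (List.mem_cons_of_mem _ h)
      · exact Or.inr fun hxZ => h (mem_insert_of_mem hxZ)

/-- A path of `k` vertices of consecutive fat pairs in a neighbourhood gives a cycle of length
`2 k`. -/
theorem cycleGraph_isContained_of_fat_path {k : ℕ} (hk : 1 ≤ k) {a : V} (l : List V)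
    (hl : l.length = k) (hnd : l.Nodup) (hch : l.IsChain (FatPair G (2 * k + 1)))
    (ha : ∀ x ∈ l, G.Adj a x) : (SimpleGraph.cycleGraph (2 * k)).IsContained G := by
  obtain _ | ⟨y, l⟩ := l
  · simp at hl
    omega
  rw [List.length_cons] at hl
  have hal : a ∉ y :: l := fun h => (ha a h).ne rfl
  -- The forbidden set has at most k + 1 vertices and k - 1 more are inserted, so codegree 2k + 1
  -- suffices.
  obtain ⟨l', h1, h2, h3, h4, h5⟩ := exists_subdivision l y (insert a (y :: l).toFinset) hnd hch
    (fun x hx => mem_insert_of_mem (List.mem_toFinset.mpr hx)) (by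
      have := card_insert_le a (y :: l).toFinset
      have := List.toFinset_card_le (y :: l)
      rw [List.length_cons] at this
      omega)
  have hal' : a ∉ y :: l' := by
    intro h
    rcases h5 a h with h | h
    · exact hal h
    · exact h (mem_insert_self _ _)
  have := cycleGraph_isContained_of_list (G := G) (a :: y :: l')
    (List.nodup_cons.mpr ⟨hal', h1⟩)
    (List.isChain_cons_cons.mpr ⟨ha y (by simp), h2⟩) (by simp) (by
      rw [List.getLast_cons (by simp), h4]
      exact (ha _ (List.getLast_mem _)).symm)
  rwa [show (a :: y :: l').length = 2 * k by simp only [List.length_cons]; omega] at this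

/-- A denser fat-pair relation would contain a path on k vertices inside the neighbourhood of `a`,
hence a 2k-cycle. -/
theorem sum_card_fatPair_le {k : ℕ} (hk : 1 ≤ k)
    (hG : (SimpleGraph.cycleGraph (2 * k)).Free G) {a : V} {S : Finset V}
    (hS : ∀ x ∈ S, G.Adj a x) :
    ∑ b ∈ S, #{d ∈ S | FatPair G (2 * k + 1) b d} ≤ 2 * (2 * k) * #S := by
  by_contra! h
  obtain ⟨l, hl, hnd, hch, hmem⟩ := exists_path_of_lt_sum (fun h => h.symm) le_rfl S h
  exact hG (cycleGraph_isContained_of_fat_path hk l hl hnd hch fun x hx => hS x (hmem x hx))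

/-- All but boundedly many vertices have fewer than `k` neighbours in a given small set. -/
theorem card_rich_le {k : ℕ} (hk : 1 ≤ k) (hG : (SimpleGraph.cycleGraph (2 * k)).Free G)
    (H : Finset V) :
    #{v | k ≤ #{h ∈ H | G.Adj v h}} ≤ 2 ^ #H * (2 * k + 1) := by
  by_contra! hlt
  rw [← card_powerset] at hlt
  -- Pigeonhole on the trace in `H`: more than 2k + 1 rich vertices share a trace `T`. They are
  -- common neighbours of any two vertices of `T`, so any k vertices of `T` form a fat path.
  obtain ⟨T, hT, hcard⟩ := exists_lt_card_fiber_of_mul_lt_card_of_maps_to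
    (f := fun v => ({h ∈ H | G.Adj v h} : Finset V)) (t := H.powerset)
    (fun v _ => mem_powerset.mpr (filter_subset _ _)) hlt
  set F := ({x ∈ ({v | k ≤ #{h ∈ H | G.Adj v h}} : Finset V) |
    ({h ∈ H | G.Adj x h} : Finset V) = T} : Finset V) with hF
  have hFT : ∀ v ∈ F, ∀ t ∈ T, G.Adj v t := by
    intro v hv t ht
    rw [hF, mem_filter] at hv
    rw [← hv.2, mem_filter] at ht
    exact ht.2
  obtain ⟨v, hv⟩ : F.Nonempty := card_pos.mp (by omega)
  have hkT : k ≤ #T := by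
    rw [hF, mem_filter, mem_filter] at hv
    rw [← hv.2]
    exact hv.1.2
  refine hG (cycleGraph_isContained_of_fat_path hk (a := v) (T.toList.take k) ?_ ?_ ?_ ?_)
  · rw [List.length_take, length_toList]
    omega
  · exact T.nodup_toList.sublist (List.take_sublist _ _)
  · refine List.Pairwise.isChain (List.Pairwise.imp_of_mem ?_
      (T.nodup_toList.sublist (List.take_sublist k _)))
    intro x y hx hy hxy
    refine ⟨hxy, (Nat.succ_le_of_lt hcard).trans' (by omega) |>.trans (card_le_card ?_)⟩
    intro w hw
    rw [mem_commonNbrs]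
    exact ⟨(hFT w hw x (mem_toList.mp (List.mem_of_mem_take hx))).symm,
      (hFT w hw y (mem_toList.mp (List.mem_of_mem_take hy))).symm⟩
  · intro x hx
    exact hFT v hv x (mem_toList.mp (List.mem_of_mem_take hx))

end fat

/-! ### Four-cycles of a C_{2k}-free graph, by high and low vertices -/

section cases

variable {V : Type*} [Fintype V] [DecidableEq V] {G : SimpleGraph V} [DecidableRel G.Adj]

theorem IsFourCycle.mem_commonNbrs {a b c d : V} (h : IsFourCycle G (a, b, c, d)) :
    b ∈ commonNbrs G a c ∧ d ∈ commonNbrs G a c :=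
  ⟨_root_.mem_commonNbrs.mpr ⟨h.1, h.2.1.symm⟩,
    _root_.mem_commonNbrs.mpr ⟨h.2.2.2.1.symm, h.2.2.1⟩⟩

theorem card_sigma_neighbor_pairs (L : Finset V) :
    #(L.sigma fun b => G.neighborFinset b ×ˢ G.neighborFinset b) = ∑ b ∈ L, G.degree b ^ 2 := by
  rw [card_sigma]
  refine sum_congr rfl fun b _ => ?_
  rw [card_product, G.card_neighborFinset_eq_degree, sq]

/-- Four-cycles `a b c d` with `b ∈ L` for which at most `m` vertices `d` fit each path `a b c`. -/
theorem fourCycleCount_le_mul_sum_degree_sq (L : Finset V) (P : V × V × V × V → Prop) (m : ℕ)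
    (F : V → V → Finset V)
    (hL : ∀ q, IsFourCycle G q → P q → q.2.1 ∈ L ∧ q.2.2.2 ∈ F q.1 q.2.2.1 ∧
      #(F q.1 q.2.2.1) ≤ m) :
    fourCycleCount G P ≤ (∑ b ∈ L, G.degree b ^ 2) * m := by
  rw [← card_sigma_neighbor_pairs, ← smul_eq_mul, ← sum_const]
  refine fourCycleCount_le_sum (fun q => (⟨q.2.1, q.1, q.2.2.1⟩ : (_ : V) × V × V)) _ _ ?_ ?_
  · rintro ⟨a, b, c, d⟩ hq hP
    simp only [mem_sigma, mem_product, SimpleGraph.mem_neighborFinset]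
    exact ⟨(hL _ hq hP).1, hq.1.symm, hq.2.1⟩
  · rintro ⟨b, a, c⟩ _
    by_cases hm : #(F a c) ≤ m
    · refine (fourCycleCount_le_card (fun q => q.2.2.2) (F a c) ?_ ?_).trans hm
      · rintro ⟨a', b', c', d'⟩ hq ⟨hP, he⟩
        simp only [Sigma.mk.injEq, heq_eq_eq, Prod.mk.injEq] at he
        obtain ⟨rfl, rfl, rfl⟩ := he
        exact (hL _ hq hP).2.1
      · rintro ⟨a', b', c', d'⟩ ⟨a'', b'', c'', d''⟩ ⟨-, he⟩ ⟨-, he'⟩ hd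
        simp only [Sigma.mk.injEq, heq_eq_eq, Prod.mk.injEq] at he he' hd ⊢
        exact ⟨he.2.1.trans he'.2.1.symm, he.1.trans he'.1.symm, he.2.2.trans he'.2.2.symm, hd⟩
    -- When `F a c` is too large, `hL` excludes every cycle in this fibre, so the fibre is empty.
    · refine (fourCycleCount_le_card (fun q => q) ∅ ?_ ?_).trans (by simp)
      · rintro ⟨a', b', c', d'⟩ hq ⟨hP, he⟩
        simp only [Sigma.mk.injEq, heq_eq_eq, Prod.mk.injEq] at he
        obtain ⟨rfl, rfl, rfl⟩ := he
        exact absurd (hL _ hq hP).2.2 hm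
      · exact fun _ _ _ _ h => h

/-- Four-cycles `a b c d` for which at most `m a c` pairs `b, d` fit. -/
theorem fourCycleCount_le_sum_opposite (P : V × V × V × V → Prop) (m : V → V → ℕ)
    (F : V → V → Finset (V × V))
    (hP : ∀ q, IsFourCycle G q → P q → (q.2.1, q.2.2.2) ∈ F q.1 q.2.2.1 ∧
      #(F q.1 q.2.2.1) ≤ m q.1 q.2.2.1) :
    fourCycleCount G P ≤ ∑ a, ∑ c, m a c := by
  rw [← Fintype.sum_prod_type']
  refine fourCycleCount_le_sum (fun q => (q.1, q.2.2.1)) univ (fun t => m t.1 t.2)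
    (fun _ _ _ => mem_univ _) ?_
  rintro ⟨a, c⟩ _
  by_cases hm : #(F a c) ≤ m a c
  · refine (fourCycleCount_le_card (fun q => (q.2.1, q.2.2.2)) (F a c) ?_ ?_).trans hm
    · rintro ⟨a', b', c', d'⟩ hq ⟨h, he⟩
      simp only [Prod.mk.injEq] at he
      obtain ⟨rfl, rfl⟩ := he
      exact (hP _ hq h).1
    · rintro ⟨a', b', c', d'⟩ ⟨a'', b'', c'', d''⟩ ⟨-, he⟩ ⟨-, he'⟩ hd
      simp only [Prod.mk.injEq] at he he' hd ⊢
      exact ⟨he.1.trans he'.1.symm, hd.1, he.2.trans he'.2.symm, hd.2⟩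
  · refine (fourCycleCount_le_card (fun q => q) ∅ ?_ ?_).trans (by simp)
    · rintro ⟨a', b', c', d'⟩ hq ⟨h, he⟩
      simp only [Prod.mk.injEq] at he
      obtain ⟨rfl, rfl⟩ := he
      exact absurd (hP _ hq h).2 hm
    · exact fun _ _ _ _ h => h

/-- Both sides count walks a b c with middle vertex in `L`. -/
theorem sum_sum_card_commonNbrs_inter (L : Finset V) :
    ∑ a, ∑ c, #{b ∈ L | b ∈ commonNbrs G a c} = ∑ b ∈ L, G.degree b ^ 2 := by
  simp_rw [card_filter]
  have : ∀ a, ∑ c, ∑ b ∈ L, (if b ∈ commonNbrs G a c then 1 else 0)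
      = ∑ b ∈ L, ∑ c, (if b ∈ commonNbrs G a c then 1 else 0) := fun a => sum_comm
  simp_rw [this]
  rw [sum_comm]
  refine sum_congr rfl fun b _ => ?_
  rw [← Fintype.sum_prod_type', ← card_filter, sq, ← G.card_neighborFinset_eq_degree,
    ← card_product]
  congr 1
  ext ⟨a, c⟩
  simp [mem_commonNbrs, G.adj_comm]

variable {k : ℕ}

/-- Four-cycles with two low-degree vertices forming a fat opposite pair. -/
theorem fourCycleCount_fat_le (hk : 1 ≤ k) (hG : (SimpleGraph.cycleGraph (2 * k)).Free G)
    (L : Finset V) :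
    fourCycleCount G (fun q => q.2.1 ∈ L ∧ q.2.2.2 ∈ L ∧ FatPair G (2 * k + 1) q.2.1 q.2.2.2)
      ≤ (∑ b ∈ L, G.degree b ^ 2) * (4 * k) := by
  refine (fourCycleCount_le_sum_opposite _
    (fun a c => #{b ∈ L | b ∈ commonNbrs G a c} * (4 * k))
    (fun a c => {p ∈ ({b ∈ L | b ∈ commonNbrs G a c} ×ˢ {b ∈ L | b ∈ commonNbrs G a c}) |
      FatPair G (2 * k + 1) p.1 p.2}) ?_).trans (le_of_eq ?_)
  · rintro ⟨a, b, c, d⟩ hq ⟨hb, hd, hf⟩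
    refine ⟨mem_filter.mpr ⟨mem_product.mpr ⟨mem_filter.mpr ⟨hb, hq.mem_commonNbrs.1⟩,
      mem_filter.mpr ⟨hd, hq.mem_commonNbrs.2⟩⟩, hf⟩, ?_⟩
    have h := sum_card_fatPair_le hk hG (a := a) (S := {b ∈ L | b ∈ commonNbrs G a c})
      fun x hx => (mem_commonNbrs.mp (mem_filter.mp hx).2).1
    simp only [card_filter _ (_ ×ˢ _), sum_product]
    simp only [card_filter (fun d => FatPair G (2 * k + 1) _ d)] at h
    linarith
  · simp_rw [← sum_mul]
    rw [sum_sum_card_commonNbrs_inter]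

/-- The vertices with at least `k` neighbours in `H`. -/
def rich (G : SimpleGraph V) [DecidableRel G.Adj] (k : ℕ) (H : Finset V) : Finset V :=
  {v | k ≤ #{h ∈ H | G.Adj v h}}

theorem card_commonNbrs_inter_le {H : Finset V} {a c : V}
    (h : ¬ (a ∈ rich G k H ∧ c ∈ rich G k H)) :
    #{x ∈ H | x ∈ commonNbrs G a c} ≤ k - 1 := by
  have key : ∀ v, v ∉ rich G k H → #{x ∈ H | G.Adj v x} ≤ k - 1 := by
    intro v hv
    simp only [rich, mem_filter, mem_univ, true_and, not_le] at hv
    omega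
  by_cases ha : a ∈ rich G k H
  · refine (card_le_card fun x hx => ?_).trans (key c fun hc => h ⟨ha, hc⟩)
    rw [mem_filter, mem_commonNbrs] at hx
    exact mem_filter.mpr ⟨hx.1, hx.2.2⟩
  · refine (card_le_card fun x hx => ?_).trans (key a ha)
    rw [mem_filter, mem_commonNbrs] at hx
    exact mem_filter.mpr ⟨hx.1, hx.2.1⟩

theorem fourCycleCount_rich_le (X Y E : Finset V) :
    fourCycleCount G (fun q => q.1 ∈ E ∧ q.2.2.1 ∈ E ∧ q.2.1 ∈ X ∧ q.2.2.2 ∈ Y)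
      ≤ #E ^ 2 * (#X * #Y) := by
  refine (fourCycleCount_le_card (fun q => ((q.1, q.2.2.1), (q.2.1, q.2.2.2)))
    ((E ×ˢ E) ×ˢ (X ×ˢ Y)) ?_ ?_).trans (le_of_eq ?_)
  · rintro ⟨a, b, c, d⟩ _ ⟨h1, h2, h3, h4⟩
    simp only [mem_product]
    exact ⟨⟨h1, h2⟩, h3, h4⟩
  · rintro ⟨a, b, c, d⟩ ⟨a', b', c', d'⟩ _ _ h
    simp only [Prod.mk.injEq] at h ⊢
    tauto
  · simp only [card_product, sq]

/-- Four-cycles with an opposite pair in `H`. -/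
theorem fourCycleCount_high_le (G : SimpleGraph V) [DecidableRel G.Adj] (k : ℕ) (H : Finset V) :
    fourCycleCount G (fun q => q.2.1 ∈ H ∧ q.2.2.2 ∈ H)
      ≤ Fintype.card V ^ 2 * ((k - 1) * (k - 2)) + #(rich G k H) ^ 2 * (#H * #H) := by
  refine (fourCycleCount_le_add (P := fun q => (q.2.1 ∈ H ∧ q.2.2.2 ∈ H) ∧
    ¬ (q.1 ∈ rich G k H ∧ q.2.2.1 ∈ rich G k H)) (Q := fun q => q.1 ∈ rich G k H ∧
    q.2.2.1 ∈ rich G k H ∧ q.2.1 ∈ H ∧ q.2.2.2 ∈ H) fun q _ h => by tauto).trans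
    (Nat.add_le_add ?_ (fourCycleCount_rich_le H H _))
  refine (fourCycleCount_le_sum_opposite _ (fun _ _ => (k - 1) * (k - 2))
    (fun a c => ({x ∈ H | x ∈ commonNbrs G a c} : Finset V).offDiag) ?_).trans (le_of_eq ?_)
  · rintro ⟨a, b, c, d⟩ hq ⟨⟨hb, hd⟩, hr⟩
    refine ⟨mem_offDiag.mpr ⟨mem_filter.mpr ⟨hb, hq.mem_commonNbrs.1⟩,
      mem_filter.mpr ⟨hd, hq.mem_commonNbrs.2⟩, hq.2.2.2.2.2⟩, ?_⟩
    have h := card_commonNbrs_inter_le hr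
    rw [offDiag_card]
    simp only at h ⊢
    set m := #{x ∈ H | x ∈ commonNbrs G a c}
    have h1 : m * m - m = m * (m - 1) := by rw [Nat.mul_sub, mul_one]
    rw [h1]
    exact Nat.mul_le_mul h (by omega)
  · simp only [sum_const, card_univ, smul_eq_mul]
    ring

/-- Four-cycles with an edge between two low-degree vertices. -/
theorem fourCycleCount_low_le (hk : 1 ≤ k) (hG : (SimpleGraph.cycleGraph (2 * k)).Free G)
    (L H : Finset V) (hLH : ∀ v, v ∈ L ∨ v ∈ H) :
    fourCycleCount G (fun q => q.1 ∈ L ∧ q.2.1 ∈ L)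
      ≤ (∑ b ∈ L, G.degree b ^ 2) * (9 * k + 2)
        + #(rich G k H) ^ 2 * (Fintype.card V * #H) := by
  set K := 2 * k + 1 with hK
  have h1 : fourCycleCount G (fun q => q.2.1 ∈ L ∧ #(commonNbrs G q.1 q.2.2.1) < K)
      ≤ (∑ b ∈ L, G.degree b ^ 2) * K := by
    refine fourCycleCount_le_mul_sum_degree_sq L _ K (fun a c => commonNbrs G a c) ?_
    rintro ⟨a, b, c, d⟩ hq ⟨hb, hc⟩
    exact ⟨hb, hq.mem_commonNbrs.2, hc.le⟩
  have h2 : fourCycleCount G (fun q => q.1 ∈ L ∧ #(commonNbrs G q.2.2.2 q.2.1) < K)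
      ≤ (∑ b ∈ L, G.degree b ^ 2) * K := by
    rw [fourCycleCount_rotate, fourCycleCount_rotate, fourCycleCount_rotate] at h1
    exact h1
  have h3 := fourCycleCount_fat_le hk hG L
  have h4 : fourCycleCount G (fun q => q.2.1 ∈ L ∧ q.2.2.2 ∈ H ∧
      ¬ (q.1 ∈ rich G k H ∧ q.2.2.1 ∈ rich G k H)) ≤ (∑ b ∈ L, G.degree b ^ 2) * k := by
    refine fourCycleCount_le_mul_sum_degree_sq L _ k
      (fun a c => {x ∈ H | x ∈ commonNbrs G a c}) ?_
    rintro ⟨a, b, c, d⟩ hq ⟨hb, hd, hr⟩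
    exact ⟨hb, mem_filter.mpr ⟨hd, hq.mem_commonNbrs.2⟩,
      (card_commonNbrs_inter_le hr).trans (Nat.sub_le _ _)⟩
  have h5 := fourCycleCount_rich_le (G := G) univ H (rich G k H)
  rw [card_univ] at h5
  -- If one of the opposite pairs is thin, a path centred at `b` or at `a` has few completions.
  -- Otherwise both are fat: if `d ∈ L`, then `b, d` is a fat pair of low vertices; if `d ∈ H`,
  -- there are few choices for `d` unless `a` and `c` are both rich.
  have hsplit : fourCycleCount G (fun q => q.1 ∈ L ∧ q.2.1 ∈ L) ≤
      fourCycleCount G (fun q => q.2.1 ∈ L ∧ #(commonNbrs G q.1 q.2.2.1) < K) +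
      (fourCycleCount G (fun q => q.1 ∈ L ∧ #(commonNbrs G q.2.2.2 q.2.1) < K) +
      (fourCycleCount G (fun q => q.2.1 ∈ L ∧ q.2.2.2 ∈ L ∧ FatPair G K q.2.1 q.2.2.2) +
      (fourCycleCount G (fun q => q.2.1 ∈ L ∧ q.2.2.2 ∈ H ∧
        ¬ (q.1 ∈ rich G k H ∧ q.2.2.1 ∈ rich G k H)) +
      fourCycleCount G (fun q => q.1 ∈ rich G k H ∧ q.2.2.1 ∈ rich G k H ∧ q.2.1 ∈ univ ∧
        q.2.2.2 ∈ H)))) := by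
    refine (fourCycleCount_le_add (Q := fun q => q.2.1 ∈ L ∧ q.1 ∈ L ∧
      ¬ #(commonNbrs G q.1 q.2.2.1) < K) ?_).trans (Nat.add_le_add_left ?_ _)
    · intro q _ h
      tauto
    refine (fourCycleCount_le_add (Q := fun q => q.2.1 ∈ L ∧
      ¬ #(commonNbrs G q.2.2.2 q.2.1) < K) ?_).trans (Nat.add_le_add_left ?_ _)
    · intro q _ h
      tauto
    refine (fourCycleCount_le_add (Q := fun q => q.2.1 ∈ L ∧ q.2.2.2 ∈ H) ?_).trans
      (Nat.add_le_add_left ?_ _)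
    · rintro ⟨a, b, c, d⟩ hq ⟨hb, hf⟩
      rcases hLH d with hd | hd
      · refine Or.inl ⟨hb, hd, hq.2.2.2.2.2, ?_⟩
        rw [commonNbrs_comm]
        exact not_lt.mp hf
      · exact Or.inr ⟨hb, hd⟩
    refine fourCycleCount_le_add ?_
    intro q _ h
    have := mem_univ q.2.1
    tauto
  calc _ ≤ _ := hsplit
    _ ≤ (∑ b ∈ L, G.degree b ^ 2) * K + ((∑ b ∈ L, G.degree b ^ 2) * K +
        ((∑ b ∈ L, G.degree b ^ 2) * (4 * k) + ((∑ b ∈ L, G.degree b ^ 2) * k +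
          #(rich G k H) ^ 2 * (Fintype.card V * #H)))) := by gcongr
    _ = _ := by
        rw [hK]
        ring

/-- Unless one of the two diagonals lies in `H`, each has a low vertex; these two are consecutive on
the cycle, so one of its four edges lies in `L`. -/
theorem fourCycleCount_le_of_even_free (hk : 1 ≤ k)
    (hG : (SimpleGraph.cycleGraph (2 * k)).Free G)
    (L H : Finset V) (hLH : ∀ v, v ∈ L ∨ v ∈ H) :
    fourCycleCount G (fun _ => True)
      ≤ 2 * (Fintype.card V ^ 2 * ((k - 1) * (k - 2)) + #(rich G k H) ^ 2 * (#H * #H))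
        + 4 * ((∑ b ∈ L, G.degree b ^ 2) * (9 * k + 2)
          + #(rich G k H) ^ 2 * (Fintype.card V * #H)) := by
  have h1 := fourCycleCount_high_le G k H
  have h2 : fourCycleCount G (fun q => q.2.2.1 ∈ H ∧ q.1 ∈ H) ≤ _ :=
    (fourCycleCount_rotate G _).symm.trans_le h1
  have h3 := fourCycleCount_low_le hk hG L H hLH
  have h4 : fourCycleCount G (fun q => q.2.1 ∈ L ∧ q.2.2.1 ∈ L) ≤ _ :=
    (fourCycleCount_rotate G _).symm.trans_le h3
  have h5 : fourCycleCount G (fun q => q.2.2.1 ∈ L ∧ q.2.2.2 ∈ L) ≤ _ :=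
    (fourCycleCount_rotate G _).symm.trans_le h4
  have h6 : fourCycleCount G (fun q => q.2.2.2 ∈ L ∧ q.1 ∈ L) ≤ _ :=
    (fourCycleCount_rotate G _).symm.trans_le h5
  have hsplit : fourCycleCount G (fun _ => True) ≤
      fourCycleCount G (fun q => q.2.1 ∈ H ∧ q.2.2.2 ∈ H) +
      (fourCycleCount G (fun q => q.2.2.1 ∈ H ∧ q.1 ∈ H) +
      (fourCycleCount G (fun q => q.1 ∈ L ∧ q.2.1 ∈ L) +
      (fourCycleCount G (fun q => q.2.1 ∈ L ∧ q.2.2.1 ∈ L) +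
      (fourCycleCount G (fun q => q.2.2.1 ∈ L ∧ q.2.2.2 ∈ L) +
      fourCycleCount G (fun q => q.2.2.2 ∈ L ∧ q.1 ∈ L))))) := by
    refine (fourCycleCount_le_add (Q := fun q => q.2.1 ∈ L ∨ q.2.2.2 ∈ L) ?_).trans
      (Nat.add_le_add_left ?_ _)
    · intro q _ _
      have := hLH q.2.1
      have := hLH q.2.2.2
      tauto
    refine (fourCycleCount_le_add (Q := fun q => (q.2.1 ∈ L ∨ q.2.2.2 ∈ L) ∧
      (q.1 ∈ L ∨ q.2.2.1 ∈ L)) ?_).trans (Nat.add_le_add_left ?_ _)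
    · intro q _ _
      have := hLH q.1
      have := hLH q.2.2.1
      tauto
    refine (fourCycleCount_le_add (Q := fun q => (q.2.1 ∈ L ∧ q.2.2.1 ∈ L) ∨
      (q.2.2.1 ∈ L ∧ q.2.2.2 ∈ L) ∨ (q.2.2.2 ∈ L ∧ q.1 ∈ L)) ?_).trans
      (Nat.add_le_add_left ?_ _)
    · intro q _ _
      tauto
    refine (fourCycleCount_le_add (Q := fun q => (q.2.2.1 ∈ L ∧ q.2.2.2 ∈ L) ∨
      (q.2.2.2 ∈ L ∧ q.1 ∈ L)) ?_).trans (Nat.add_le_add_left ?_ _)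
    · intro q _ h
      exact h
    exact fourCycleCount_le_add fun q _ h => h
  omega

end cases

/-! ### Graphs without a given odd cycle -/

section odd

variable {V : Type*} [Fintype V] [DecidableEq V] {G : SimpleGraph V} [DecidableRel G.Adj] {l : ℕ}

/-- A path on 2l vertices inside the neighbourhood of `x` would close through `x` to an odd cycle.
-/
theorem sum_card_adj_neighbors_le (hG : (SimpleGraph.cycleGraph (2 * l + 1)).Free G)
    (hl : 1 ≤ l) (x : V) :
    ∑ a ∈ G.neighborFinset x, #{b ∈ G.neighborFinset x | G.Adj a b}
      ≤ 2 * (4 * l) * G.degree x := by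
  by_contra! h
  rw [← G.card_neighborFinset_eq_degree] at h
  obtain ⟨p, hp, hnd, hch, hmem⟩ :=
    exists_path_of_lt_sum (R := G.Adj) (fun h => h.symm) (m := 2 * l) (by omega) _ h
  obtain _ | ⟨y, p⟩ := p
  · simp at hp
    omega
  have hx : ∀ v ∈ y :: p, G.Adj x v := fun v hv => by simpa using hmem v hv
  have := cycleGraph_isContained_of_list (G := G) (x :: y :: p)
    (List.nodup_cons.mpr ⟨fun h => (hx x h).ne rfl, hnd⟩)
    (List.isChain_cons_cons.mpr ⟨hx y (by simp), hch⟩) (by simp) (by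
      rw [List.getLast_cons (by simp)]
      exact (hx _ (List.getLast_mem _)).symm)
  rw [List.length_cons, hp] at this
  exact hG this

/-- Counts ordered triangles by regrouping them at their third vertex. -/
theorem sum_card_commonNbrs_le (hG : (SimpleGraph.cycleGraph (2 * l + 1)).Free G) (hl : 1 ≤ l) :
    ∑ a, ∑ b ∈ G.neighborFinset a, #(commonNbrs G a b) ≤ 8 * l * Fintype.card V ^ 2 := by
  have h1 : ∑ a, ∑ b ∈ G.neighborFinset a, #(commonNbrs G a b)
      = ∑ x, ∑ a ∈ G.neighborFinset x, #{b ∈ G.neighborFinset x | G.Adj a b} := by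
    have h2 : ∀ a x, ∑ b ∈ G.neighborFinset a,
        (if G.Adj a x ∧ G.Adj b x then 1 else 0)
        = if a ∈ G.neighborFinset x then #{b ∈ G.neighborFinset x | G.Adj a b} else 0 := by
      intro a x
      rw [← card_filter]
      split_ifs with h
      · congr 1
        ext b
        simp only [mem_filter, SimpleGraph.mem_neighborFinset] at h ⊢
        exact ⟨fun hb => ⟨hb.2.2.symm, hb.1⟩, fun hb => ⟨hb.2, h.symm, hb.1.symm⟩⟩
      · rw [card_eq_zero, filter_eq_empty_iff]
        intro b _ hb
        exact h (by simpa using hb.1.symm)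
    calc ∑ a, ∑ b ∈ G.neighborFinset a, #(commonNbrs G a b)
        = ∑ a, ∑ x, ∑ b ∈ G.neighborFinset a, (if G.Adj a x ∧ G.Adj b x then 1 else 0) := by
          refine sum_congr rfl fun a _ => ?_
          rw [sum_comm]
          refine sum_congr rfl fun b _ => ?_
          rw [commonNbrs, card_filter]
      _ = ∑ x, ∑ a, if a ∈ G.neighborFinset x then
            #{b ∈ G.neighborFinset x | G.Adj a b} else 0 := by
          rw [sum_comm]
          simp_rw [h2]
      _ = _ := by
          refine sum_congr rfl fun x _ => ?_
          rw [← sum_filter]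
          congr 1
          ext a
          simp
  rw [h1]
  refine (sum_le_sum fun x _ => (sum_card_adj_neighbors_le hG hl x).trans
    (Nat.mul_le_mul_left _ (degree_le_card x))).trans (le_of_eq ?_)
  rw [sum_const, card_univ, smul_eq_mul]
  ring

theorem degree_add_degree_le (a b : V) :
    G.degree a + G.degree b ≤ Fintype.card V + #(commonNbrs G a b) := by
  rw [← G.card_neighborFinset_eq_degree, ← G.card_neighborFinset_eq_degree,
    ← card_union_add_card_inter]
  refine Nat.add_le_add (card_le_univ _) (card_le_card fun v hv => ?_)
  simpa [mem_commonNbrs] using hv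

/-- Mantel's proof with an error term: sum d(a) + d(b) ≤ n + codeg(a, b) over adjacent pairs and
compare with Cauchy–Schwarz. -/
theorem two_mul_sum_degree_le (hG : (SimpleGraph.cycleGraph (2 * l + 1)).Free G) (hl : 1 ≤ l) :
    2 * ∑ v, G.degree v ≤ Fintype.card V ^ 2 + 16 * l * Fintype.card V := by
  set n := Fintype.card V with hn
  set m := ∑ v, G.degree v with hm
  have h1 : 2 * ∑ v, G.degree v ^ 2 ≤ n * m + 8 * l * n ^ 2 := by
    have h2 : ∑ a, ∑ b ∈ G.neighborFinset a, (G.degree a + G.degree b)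
        = 2 * ∑ v, G.degree v ^ 2 := by
      simp_rw [sum_add_distrib]
      rw [sum_sum_degree_neighbor, two_mul]
      congr 1
      refine sum_congr rfl fun x _ => ?_
      rw [sum_const, G.card_neighborFinset_eq_degree, smul_eq_mul, sq]
    rw [← h2]
    refine (sum_le_sum fun a _ => sum_le_sum fun b _ => degree_add_degree_le a b).trans ?_
    simp_rw [sum_add_distrib]
    refine Nat.add_le_add (le_of_eq ?_) (sum_card_commonNbrs_le hG hl)
    simp_rw [sum_const, G.card_neighborFinset_eq_degree, smul_eq_mul]
    rw [← sum_mul, mul_comm]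
  have h3 : m ^ 2 ≤ n * ∑ v, G.degree v ^ 2 := by
    have := sq_sum_le_card_mul_sum_sq (s := (univ : Finset V)) (f := fun v => G.degree v)
    rwa [card_univ] at this
  by_contra! h
  have h4 : 2 * m ^ 2 ≤ n ^ 2 * m + 8 * l * n ^ 3 := by nlinarith
  have h5 : m * (n ^ 2 + 16 * l * n) ≤ m * (2 * m) := Nat.mul_le_mul_left _ h.le
  have hn0 : 0 < n := by
    rcases Nat.eq_zero_or_pos n with h0 | h0
    · have : m = 0 := by
        have := Fintype.card_eq_zero_iff.mp h0
        simp [hm]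
      omega
    · exact h0
  have h6 : n ^ 2 < 2 * m := by
    have : 0 ≤ 16 * l * n := Nat.zero_le _
    omega
  -- `h4` and `h5` yield the reverse inequality 16lnm ≤ 8ln³; positivity of `n` and `l` makes this
  -- one strict.
  have h7 : 8 * l * n * n ^ 2 < 8 * l * n * (2 * m) :=
    Nat.mul_lt_mul_of_pos_left h6 (by positivity)
  nlinarith

/-- Once the edge (a, b) is fixed, `d` is a neighbour of `a` and `c` a neighbour of `b`. -/
theorem fourCycleCount_le_sum_degree (G : SimpleGraph V) [DecidableRel G.Adj] :
    fourCycleCount G (fun _ => True)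
      ≤ ∑ a, ∑ b ∈ G.neighborFinset a, G.degree a * G.degree b := by
  rw [sum_sigma']
  refine fourCycleCount_le_sum (fun q => (⟨q.1, q.2.1⟩ : (_ : V) × V)) _ _ ?_ ?_
  · rintro ⟨a, b, c, d⟩ hq _
    simpa using hq.1
  · rintro ⟨a, b⟩ _
    refine (fourCycleCount_le_card (fun q => (q.2.2.2, q.2.2.1))
      (G.neighborFinset a ×ˢ G.neighborFinset b) ?_ ?_).trans (le_of_eq ?_)
    · rintro ⟨a', b', c, d⟩ hq ⟨-, he⟩
      simp only [Sigma.mk.injEq, heq_eq_eq] at he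
      obtain ⟨rfl, rfl⟩ := he
      simp only [mem_product, SimpleGraph.mem_neighborFinset]
      exact ⟨hq.2.2.2.1.symm, hq.2.1⟩
    · rintro ⟨a', b', c', d'⟩ ⟨a'', b'', c'', d''⟩ ⟨-, he⟩ ⟨-, he'⟩ hd
      simp only [Sigma.mk.injEq, heq_eq_eq, Prod.mk.injEq] at he he' hd ⊢
      exact ⟨he.1.trans he'.1.symm, he.2.trans he'.2.symm, hd.2, hd.1⟩
    · rw [card_product, G.card_neighborFinset_eq_degree, G.card_neighborFinset_eq_degree]

/-- By AM-GM, 4 d(a)d(b) ≤ (n + t)² ≤ n² + 3nt, where t ≤ n is the codegree of a and b. Summing over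
adjacent pairs leaves only the degree sum and the triangle count. -/
theorem fourCycleCount_le_of_odd_free (hG : (SimpleGraph.cycleGraph (2 * l + 1)).Free G)
    (hl : 1 ≤ l) :
    8 * fourCycleCount G (fun _ => True)
      ≤ Fintype.card V ^ 4 + 64 * l * Fintype.card V ^ 3 := by
  set n := Fintype.card V with hn
  have h1 : 4 * ∑ a, ∑ b ∈ G.neighborFinset a, G.degree a * G.degree b
      ≤ n ^ 2 * ∑ v, G.degree v
        + 3 * n * ∑ a, ∑ b ∈ G.neighborFinset a, #(commonNbrs G a b) := by
    have h2 : ∀ a b, 4 * (G.degree a * G.degree b) ≤ n ^ 2 + 3 * n * #(commonNbrs G a b) := by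
      intro a b
      have h3 : #(commonNbrs G a b) ≤ n := card_le_univ _
      have h4 := degree_add_degree_le (G := G) a b
      have h5 : (G.degree a + G.degree b) ^ 2 ≤ (n + #(commonNbrs G a b)) ^ 2 :=
        Nat.pow_le_pow_left h4 2
      have h6 := Nat.mul_le_mul_right #(commonNbrs G a b) h3
      have h7 : 4 * (G.degree a * G.degree b) ≤ (G.degree a + G.degree b) ^ 2 := by
        have := four_mul_le_sq_add (G.degree a) (G.degree b)
        linarith
      nlinarith
    calc 4 * ∑ a, ∑ b ∈ G.neighborFinset a, G.degree a * G.degree b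
        = ∑ a, ∑ b ∈ G.neighborFinset a, 4 * (G.degree a * G.degree b) := by
          simp_rw [mul_sum]
      _ ≤ ∑ a, ∑ b ∈ G.neighborFinset a, (n ^ 2 + 3 * n * #(commonNbrs G a b)) :=
          sum_le_sum fun a _ => sum_le_sum fun b _ => h2 a b
      _ = _ := by
          simp_rw [sum_add_distrib, sum_const, G.card_neighborFinset_eq_degree, smul_eq_mul,
            mul_sum]
          congr 1
          exact sum_congr rfl fun _ _ => mul_comm _ _
  have h2 := fourCycleCount_le_sum_degree G
  have h3 := two_mul_sum_degree_le hG hl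
  have h4 := sum_card_commonNbrs_le hG hl
  have h5 := Nat.mul_le_mul_left (n ^ 2) h3
  have h6 := Nat.mul_le_mul_left (3 * n) h4
  nlinarith

end odd

/-! ### The extremal complete bipartite graphs -/

section bipartite

/-- The complete bipartite graph on `Fin n` whose one side is `{0, …, p - 1}`. -/
def completeBipartiteFin (n p : ℕ) : SimpleGraph (Fin n) where
  Adj i j := ¬ (i.val < p ↔ j.val < p)
  symm := ⟨fun _ _ h h' => h h'.symm⟩
  loopless := ⟨fun _ h => h Iff.rfl⟩

theorem completeBipartiteFin_adj {n p : ℕ} {i j : Fin n} :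
    (completeBipartiteFin n p).Adj i j ↔ ¬ (i.val < p ↔ j.val < p) := Iff.rfl

/-- The sides alternate along the cycle, so the parity of the index decides the side. -/
theorem lt_iff_of_copy {n p m : ℕ}
    (f : (SimpleGraph.cycleGraph m).Copy (completeBipartiteFin n p)) (hm : 0 < m) (i : ℕ) :
    ∀ hi : i < m, ((f ⟨i, hi⟩).val < p ↔ ((f ⟨0, hm⟩).val < p ↔ Even i)) := by
  induction i with
  | zero =>
    intro _
    simp
  | succ i ih =>
    intro hi
    have h1 : (SimpleGraph.pathGraph m).Adj ⟨i, by omega⟩ ⟨i + 1, hi⟩ := by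
      rw [SimpleGraph.pathGraph_adj]
      exact Or.inl rfl
    have h2 := f.toHom.map_adj (SimpleGraph.pathGraph_le_cycleGraph h1)
    rw [completeBipartiteFin_adj] at h2
    have h3 := ih (by omega)
    rw [Nat.even_add_one]
    simp only [SimpleGraph.Copy.coe_toHom] at h2
    tauto

theorem odd_cycleGraph_free_completeBipartiteFin {n p m : ℕ} (hm : 3 ≤ m) (ho : Odd m) :
    (SimpleGraph.cycleGraph m).Free (completeBipartiteFin n p) := by
  rintro ⟨f⟩
  have h1 : (SimpleGraph.cycleGraph m).Adj ⟨m - 1, by omega⟩ ⟨0, by omega⟩ := by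
    rw [SimpleGraph.cycleGraph_adj']
    right
    rw [Fin.val_sub]
    simp only
    rw [show m - (m - 1) + 0 = 1 by omega, Nat.mod_eq_of_lt (by omega)]
  have h2 := f.toHom.map_adj h1
  rw [completeBipartiteFin_adj] at h2
  have h3 := lt_iff_of_copy f (by omega) (m - 1) (by omega)
  have h4 : Even (m - 1) := by
    obtain ⟨r, rfl⟩ := ho
    exact ⟨r, by omega⟩
  simp only [SimpleGraph.Copy.coe_toHom] at h2
  tauto

/-- One of the two parity classes, j vertices in all, would have to fit injectively into the side of
size `p`. -/
theorem even_cycleGraph_free_completeBipartiteFin {n p j : ℕ} (hj : p < j) :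
    (SimpleGraph.cycleGraph (2 * j)).Free (completeBipartiteFin n p) := by
  rintro ⟨f⟩
  have key : ∃ e ≤ 1, ∀ i (hi : 2 * i + e < 2 * j), (f ⟨2 * i + e, hi⟩).val < p := by
    by_cases h0 : (f ⟨0, by omega⟩).val < p
    · refine ⟨0, by omega, fun i hi => ?_⟩
      rw [lt_iff_of_copy f (by omega) _ hi]
      simp [h0]
    · refine ⟨1, le_rfl, fun i hi => ?_⟩
      rw [lt_iff_of_copy f (by omega) _ hi]
      simp [h0]
  obtain ⟨e, he, h⟩ := key
  have := Fintype.card_le_of_injective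
    (fun i : Fin j => (⟨_, h i.1 (by have := i.2; omega)⟩ : Fin p)) (by
      intro a b hab
      simp only [Fin.mk.injEq] at hab
      have := f.injective (Fin.ext hab)
      simp only [Fin.mk.injEq] at this
      ext
      omega)
  simp only [Fintype.card_fin] at this
  omega

/-- Ordered pairs of distinct vertices, one pair from each side, give the labelled four-cycles that
start in `A`; a rotation gives as many that start in `B`. Two such families against eight labellings
leave the factor 4. -/
theorem le_copyCount_completeBipartiteFin {n p : ℕ} (hp : p ≤ n) :
    (p * p - p) * ((n - p) * (n - p) - (n - p))
      ≤ 4 * (completeBipartiteFin n p).copyCount (SimpleGraph.cycleGraph 4) := by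
  classical
  set G := completeBipartiteFin n p with hG
  set A : Finset (Fin n) := {i | i.val < p} with hA
  set B : Finset (Fin n) := {i | ¬ i.val < p} with hB
  have hAc : #A = p := by
    rw [hA, Fin.card_filter_val_lt]
    omega
  have hBc : #B = n - p := by
    have := card_filter_add_card_filter_not (s := (univ : Finset (Fin n))) (fun i => i.val < p)
    rw [card_univ, Fintype.card_fin] at this
    change #A + #B = n at this
    omega
  have h1 : #A.offDiag * #B.offDiag ≤ fourCycleCount G (fun q => q.1 ∈ A) := by
    rw [← card_product]
    refine card_le_card_of_injOn (fun t => (t.1.1, t.2.1, t.1.2, t.2.2)) ?_ ?_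
    · rintro ⟨⟨a, c⟩, ⟨b, d⟩⟩ h
      simp only [coe_product, Set.mem_prod, mem_coe, mem_offDiag, hA, hB, mem_filter, mem_univ,
        true_and] at h
      obtain ⟨⟨ha, hc, hac⟩, hb, hd, hbd⟩ := h
      refine mem_fourCycles.mpr ⟨⟨?_, ?_, ?_, ?_, hac, hbd⟩, by simpa [hA] using ha⟩ <;>
        rw [hG, completeBipartiteFin_adj] <;> tauto
    · rintro ⟨⟨a, c⟩, ⟨b, d⟩⟩ _ ⟨⟨a', c'⟩, ⟨b', d'⟩⟩ _ h
      simp only [Prod.mk.injEq] at h ⊢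
      tauto
  have h2 : #A.offDiag * #B.offDiag ≤ fourCycleCount G (fun q => q.2.1 ∈ A) :=
    h1.trans_eq (fourCycleCount_rotate G _)
  have h3 : fourCycleCount G (fun q => q.1 ∈ A) + fourCycleCount G (fun q => q.2.1 ∈ A)
      ≤ fourCycleCount G (fun _ => True) := by
    unfold fourCycleCount
    rw [← card_union_of_disjoint]
    · refine card_le_card fun q hq => ?_
      rw [mem_union, mem_fourCycles, mem_fourCycles] at hq
      exact mem_fourCycles.mpr ⟨by tauto, trivial⟩
    · rw [Finset.disjoint_left]
      intro q hq hq'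
      rw [mem_fourCycles] at hq hq'
      have := hq.1.1
      rw [hG, completeBipartiteFin_adj] at this
      simp only [hA, mem_filter, mem_univ, true_and] at hq hq'
      tauto
  rw [fourCycleCount_eq] at h3
  rw [offDiag_card, offDiag_card, hAc, hBc] at h1 h2
  omega

end bipartite

/-! ### From finite bounds to asymptotics -/

section asymptotics

theorem isEquivalent_const_mul_pow {u : ℕ → ℝ} {C : ℝ} (hC : 0 < C) (r : ℕ)
    (hl : ∀ δ > 0, ∀ᶠ n : ℕ in atTop, (C - δ) * (n : ℝ) ^ r ≤ u n)
    (hu : ∀ δ > 0, ∀ᶠ n : ℕ in atTop, u n ≤ (C + δ) * (n : ℝ) ^ r) :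
    u ~[atTop] fun n : ℕ => C * (n : ℝ) ^ r := by
  refine IsLittleO.of_bound fun ε hε => ?_
  filter_upwards [hl (ε * C) (by positivity), hu (ε * C) (by positivity)] with n h1 h2
  have h3 : 0 ≤ C * (n : ℝ) ^ r := by positivity
  rw [Pi.sub_apply, Real.norm_eq_abs, Real.norm_eq_abs, abs_of_nonneg h3, abs_le]
  constructor <;> nlinarith

theorem eventually_const_le_mul {A δ : ℝ} (hδ : 0 < δ) : ∀ᶠ n : ℕ in atTop, A ≤ δ * n := by
  have h : Tendsto (fun n : ℕ => δ * (n : ℝ)) atTop atTop :=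
    tendsto_natCast_atTop_atTop.const_mul_atTop hδ
  exact h.eventually_ge_atTop A

open Classical in
theorem generalizedTuran_le {ι : Type} {W : ι → Type} {F : ∀ i, SimpleGraph (W i)} {U : Type}
    {H : SimpleGraph U} {n : ℕ} {B : ℝ} (hB : 0 ≤ B)
    (h : ∀ G : SimpleGraph (Fin n), FamilyFree F G → (G.copyCount H : ℝ) ≤ B) :
    (generalizedTuran n H F : ℝ) ≤ B := by
  rw [← Nat.le_floor_iff hB, generalizedTuran]
  refine Finset.sup_le fun G hG => ?_
  rw [Nat.le_floor_iff hB]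
  exact h G (mem_filter.mp hG).2

theorem copyCount_le_generalizedTuran {ι : Type} {W : ι → Type} {F : ∀ i, SimpleGraph (W i)}
    {U : Type} {H : SimpleGraph U} {n : ℕ} {G : SimpleGraph (Fin n)} (hG : FamilyFree F G) :
    G.copyCount H ≤ generalizedTuran n H F := by
  classical
  unfold generalizedTuran
  exact Finset.le_sup (f := fun G : SimpleGraph (Fin n) => G.copyCount H)
    (mem_filter.mpr ⟨mem_univ _, hG⟩)

/-- After division by `M`, the walk term contributes 2δn², the part εn of the threshold `D`
contributes 2δn², and its rounding error contributes δn². -/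
theorem low_degree_bound {B C M D S ε δ n : ℝ} (hB : 0 ≤ B) (hM : 0 < M) (hn : 0 ≤ n)
    (hS : M * S ≤ C * n ^ 2 + M ^ 2 * D * n) (h1 : 2 * B * C ≤ M * δ) (h2 : 2 * B * M * ε = δ)
    (hD : D ≤ ε * n + 1) (h3 : 4 * B * M ≤ δ * n) : 4 * (S * B) ≤ 5 * δ * n ^ 2 := by
  have hδ : 0 ≤ δ * n ^ 2 := by
    rw [sq, ← mul_assoc]
    exact mul_nonneg (h3.trans' (by positivity)) hn
  have e1 := mul_le_mul_of_nonneg_left hS (by positivity : 0 ≤ 4 * B)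
  have e2 := mul_le_mul_of_nonneg_right h1 (by positivity : 0 ≤ 2 * n ^ 2)
  have e3 := mul_le_mul_of_nonneg_left hD (by positivity : 0 ≤ 4 * B * M ^ 2 * n)
  have e4 := mul_le_mul_of_nonneg_right h3 (by positivity : 0 ≤ M * n)
  have e5 : 4 * B * M ^ 2 * n * (ε * n + 1) = 2 * M * (δ * n ^ 2) + 4 * B * M ^ 2 * n := by
    rw [← h2]
    ring
  refine le_of_mul_le_mul_left ?_ hM
  have e6 := mul_nonneg hM.le hδ
  linarith

theorem eventually_copyCount_le_of_even_free {k : ℕ} (hk : 3 ≤ k) {δ : ℝ} (hδ : 0 < δ) :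
    ∀ᶠ n : ℕ in atTop, ∀ G : SimpleGraph (Fin n), (SimpleGraph.cycleGraph (2 * k)).Free G →
      (G.copyCount (SimpleGraph.cycleGraph 4) : ℝ)
        ≤ (((k : ℝ) - 1) * ((k : ℝ) - 2) / 4 + δ) * (n : ℝ) ^ 2 := by
  set c := 2 * k with hc
  set C₂ : ℕ := (1 + c) * (1 + 2 * c) + c * (2 + 6 * c) with hC₂
  set B : ℕ := 9 * k + 2 with hB
  have hBpos : (0 : ℝ) < B := by positivity
  -- The order of choice matters: `M` large makes the walk term small, then ε small in terms of `M`
  -- controls the remaining term of the low-degree sum, and `h₀` and `E₀` bound the high and the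
  -- rich vertices for this ε. None of them depends on n.
  obtain ⟨M, hM⟩ := exists_nat_gt (2 * B * C₂ / δ)
  have hM0 : (0 : ℝ) < M := lt_of_le_of_lt (by positivity) hM
  set ε : ℝ := δ / (2 * B * M) with hε
  have hε0 : 0 < ε := by positivity
  obtain ⟨h₀, hh₀⟩ := exists_nat_gt ((1 + 2 * c) / ε ^ 2)
  set E₀ : ℕ := 2 ^ h₀ * (2 * k + 1) with hE₀
  filter_upwards [eventually_const_le_mul (A := 4 * B * M) hδ,
    eventually_const_le_mul (A := 2 * E₀ ^ 2 * h₀ ^ 2 + 4 * E₀ ^ 2 * h₀) hδ,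
    eventually_ge_atTop 1] with n hn1 hn2 hn3 G hG
  classical
  have hnR : (1 : ℝ) ≤ n := by exact_mod_cast hn3
  set D : ℕ := ⌈ε * n⌉₊ with hD
  have hD1 : ε * n ≤ D := Nat.le_ceil _
  have hD2 : (D : ℝ) ≤ ε * n + 1 := (Nat.ceil_lt_add_one (by positivity)).le
  set L : Finset (Fin n) := {v | G.degree v < D} with hL
  set H : Finset (Fin n) := {v | ¬ G.degree v < D} with hH
  set S : ℕ := ∑ v ∈ L, G.degree v ^ 2 with hS
  have hS1 : (M : ℝ) * S ≤ C₂ * n ^ 2 + M ^ 2 * D * n := by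
    have h1 := mul_sum_degree_sq_le G D M
    have h2 := sum_degree_mul_degree_le hk le_rfl hG
    rw [Fintype.card_fin] at h1 h2
    have h3 := h1.trans (Nat.add_le_add_right h2 _)
    exact_mod_cast h3
  have hHc : #H ≤ h₀ := by
    have h1 := sum_degree_sq_le (by omega) le_rfl hG
    rw [Fintype.card_fin] at h1
    have h2 : #H * D ^ 2 ≤ ∑ x, G.degree x ^ 2 := by
      rw [← smul_eq_mul]
      refine le_trans (card_nsmul_le_sum H _ _ fun v hv => ?_) (sum_le_sum_of_subset (subset_univ H))
      exact Nat.pow_le_pow_left (not_lt.mp (mem_filter.mp hv).2) 2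
    have h3 : (#H : ℝ) * D ^ 2 ≤ (1 + 2 * c) * n ^ 2 := by exact_mod_cast h2.trans h1
    have h4 : (ε * n) ^ 2 ≤ (D : ℝ) ^ 2 := pow_le_pow_left₀ (by positivity) hD1 2
    have h5 : (#H : ℝ) * ε ^ 2 * n ^ 2 ≤ (1 + 2 * c) * n ^ 2 := by
      refine le_trans ?_ h3
      rw [mul_assoc, ← mul_pow]
      exact mul_le_mul_of_nonneg_left h4 (by positivity)
    have h6 : (#H : ℝ) * ε ^ 2 ≤ 1 + 2 * c := le_of_mul_le_mul_right h5 (by positivity)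
    have h7 : (#H : ℝ) ≤ (1 + 2 * c) / ε ^ 2 := by rwa [le_div_iff₀ (by positivity)]
    exact_mod_cast (h7.trans hh₀.le)
  have hE : #(rich G k H) ≤ E₀ :=
    (card_rich_le (by omega) hG H).trans
      (Nat.mul_le_mul_right _ (Nat.pow_le_pow_right (by norm_num) hHc))
  have hQ := fourCycleCount_le_of_even_free (by omega) hG L H fun v =>
    (lt_or_ge (G.degree v) D).imp (fun hv => mem_filter.mpr ⟨mem_univ _, hv⟩)
      fun hv => mem_filter.mpr ⟨mem_univ _, not_lt.mpr hv⟩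
  rw [fourCycleCount_eq, Fintype.card_fin] at hQ
  have hQ' : 8 * G.copyCount (SimpleGraph.cycleGraph 4)
      ≤ 2 * (n ^ 2 * ((k - 1) * (k - 2)) + E₀ ^ 2 * (h₀ * h₀))
        + 4 * (S * B + E₀ ^ 2 * (n * h₀)) := by
    refine hQ.trans ?_
    gcongr
  have hQR : 8 * (G.copyCount (SimpleGraph.cycleGraph 4) : ℝ)
      ≤ 2 * ((n : ℝ) ^ 2 * (((k : ℝ) - 1) * ((k : ℝ) - 2)) + (E₀ : ℝ) ^ 2 * (h₀ * h₀))
        + 4 * ((S : ℝ) * B + (E₀ : ℝ) ^ 2 * (n * h₀)) := by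
    have := (Nat.cast_le (α := ℝ)).mpr hQ'
    push_cast [Nat.cast_sub (show 1 ≤ k by omega), Nat.cast_sub (show 2 ≤ k by omega)] at this
    exact this
  have hSB : 4 * ((S : ℝ) * B) ≤ 5 * δ * n ^ 2 := by
    have h1 : 2 * (B : ℝ) * C₂ ≤ M * δ := by
      rw [div_lt_iff₀ hδ] at hM
      exact hM.le
    have h2 : 2 * (B : ℝ) * M * ε = δ := by
      rw [hε]
      field_simp
    exact low_degree_bound (Nat.cast_nonneg B) hM0 (Nat.cast_nonneg n) hS1 h1 h2 hD2 hn1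
  have hrest : 2 * ((E₀ : ℝ) ^ 2 * (h₀ * h₀)) + 4 * ((E₀ : ℝ) ^ 2 * (n * h₀)) ≤ δ * n ^ 2 := by
    have e1 : 2 * ((E₀ : ℝ) ^ 2 * (h₀ * h₀)) ≤ 2 * ((E₀ : ℝ) ^ 2 * (h₀ * h₀)) * n :=
      le_mul_of_one_le_right (by positivity) hnR
    have e2 := mul_le_mul_of_nonneg_right hn2 (by positivity : (0 : ℝ) ≤ n)
    linarith
  -- The errors add up to 6δn², within the 8δn² that eight labellings per copy allow.
  have hδn : 0 ≤ δ * (n : ℝ) ^ 2 := by positivity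
  linarith

theorem eventually_copyCount_le_of_odd_free {l : ℕ} (hl : 1 ≤ l) {δ : ℝ} (hδ : 0 < δ) :
    ∀ᶠ n : ℕ in atTop, ∀ G : SimpleGraph (Fin n), (SimpleGraph.cycleGraph (2 * l + 1)).Free G →
      (G.copyCount (SimpleGraph.cycleGraph 4) : ℝ) ≤ (1 / 64 + δ) * (n : ℝ) ^ 4 := by
  filter_upwards [eventually_const_le_mul (A := l) hδ] with n hn G hG
  classical
  have h := fourCycleCount_le_of_odd_free hG hl
  rw [fourCycleCount_eq, Fintype.card_fin] at h
  have h' : 8 * (8 * (G.copyCount (SimpleGraph.cycleGraph 4) : ℝ))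
      ≤ (n : ℝ) ^ 4 + 64 * l * (n : ℝ) ^ 3 := by exact_mod_cast h
  have h2 := mul_le_mul_of_nonneg_right hn (by positivity : (0 : ℝ) ≤ (n : ℝ) ^ 3)
  nlinarith

/-- The number of four-cycles of a complete bipartite graph, as a real lower bound. -/
theorem le_copyCount_completeBipartiteFin_real {n p : ℕ} (hp : p ≤ n) :
    ((p : ℝ) * (p - 1)) * (((n : ℝ) - p) * ((n : ℝ) - p - 1))
      ≤ 4 * ((completeBipartiteFin n p).copyCount (SimpleGraph.cycleGraph 4) : ℝ) := by
  have h := (Nat.cast_le (α := ℝ)).mpr (le_copyCount_completeBipartiteFin hp)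
  push_cast [Nat.cast_sub (Nat.le_mul_self p), Nat.cast_sub (Nat.le_mul_self (n - p)),
    Nat.cast_sub hp] at h
  refine le_trans (le_of_eq ?_) h
  ring

theorem eventually_le_copyCount_of_fixed_side (p : ℕ) {δ : ℝ} (hδ : 0 < δ) :
    ∀ᶠ n : ℕ in atTop, ((p : ℝ) * (p - 1) / 4 - δ) * (n : ℝ) ^ 2
      ≤ ((completeBipartiteFin n p).copyCount (SimpleGraph.cycleGraph 4) : ℝ) := by
  filter_upwards [eventually_const_le_mul (A := (p : ℝ) * (p - 1) * (2 * p + 1)) hδ,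
    eventually_ge_atTop p] with n hn hp
  have h := le_copyCount_completeBipartiteFin_real hp
  have h0 : (0 : ℝ) ≤ (p : ℝ) * (p - 1) := by
    rcases Nat.eq_zero_or_pos p with rfl | h'
    · simp
    · have : (1 : ℝ) ≤ p := by exact_mod_cast h'
      exact mul_nonneg (by positivity) (by linarith)
  have h1 : (n : ℝ) ^ 2 - (2 * p + 1) * n ≤ ((n : ℝ) - p) * ((n : ℝ) - p - 1) := by
    nlinarith [sq_nonneg (p : ℝ), (Nat.cast_nonneg p : (0 : ℝ) ≤ p)]
  have h2 := mul_le_mul_of_nonneg_left h1 h0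
  have h3 := mul_le_mul_of_nonneg_right hn (by positivity : (0 : ℝ) ≤ n)
  nlinarith [mul_nonneg hδ.le (sq_nonneg (n : ℝ))]

theorem eventually_le_copyCount_of_half {δ : ℝ} (hδ : 0 < δ) :
    ∀ᶠ n : ℕ in atTop, (1 / 64 - δ) * (n : ℝ) ^ 4
      ≤ ((completeBipartiteFin n (n / 2)).copyCount (SimpleGraph.cycleGraph 4) : ℝ) := by
  filter_upwards [eventually_const_le_mul (A := 1) hδ, eventually_ge_atTop 3] with n hn hn3
  have h := le_copyCount_completeBipartiteFin_real (Nat.div_le_self n 2)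
  have h1 : (n : ℝ) ≤ 2 * ((n / 2 : ℕ) : ℝ) + 1 := by
    exact_mod_cast (by omega : n ≤ 2 * (n / 2) + 1)
  have h2 : 2 * ((n / 2 : ℕ) : ℝ) ≤ n := by exact_mod_cast (by omega : 2 * (n / 2) ≤ n)
  set p : ℝ := ((n / 2 : ℕ) : ℝ)
  have hn3' : (3 : ℝ) ≤ n := by exact_mod_cast hn3
  -- A common lower bound for p - 1 and n - p - 1 that covers both parities of n.
  set x : ℝ := ((n : ℝ) - 3) / 2 with hx
  have hx0 : 0 ≤ x := by rw [hx]; linarith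
  have h3 : x * x ≤ p * (p - 1) := mul_le_mul (by linarith) (by linarith) hx0 (by linarith)
  have h4 : x * x ≤ ((n : ℝ) - p) * ((n : ℝ) - p - 1) :=
    mul_le_mul (by linarith) (by linarith) hx0 (by linarith)
  have h5 := mul_le_mul h3 h4 (by positivity) ((mul_nonneg hx0 hx0).trans h3)
  have h6 : (n : ℝ) ^ 4 - 12 * (n : ℝ) ^ 3 ≤ 16 * ((x * x) * (x * x)) := by
    rw [hx]
    have : 16 * ((((n : ℝ) - 3) / 2 * (((n : ℝ) - 3) / 2)) * (((n : ℝ) - 3) / 2 *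
      (((n : ℝ) - 3) / 2))) = (n : ℝ) ^ 4 - 12 * (n : ℝ) ^ 3 + (54 * (n : ℝ) ^ 2
        - 108 * n + 81) := by ring
    rw [this]
    nlinarith
  have h7 := mul_le_mul_of_nonneg_right hn (by positivity : (0 : ℝ) ≤ (n : ℝ) ^ 3)
  nlinarith

end asymptotics

/-! ### Assembly of the three cases -/

theorem theorem2p9 (A : Set ℕ) (hA : ∀ a ∈ A, 3 ≤ a) (hne : A.Nonempty) :
    (4 ∈ A →
      ∀ n : ℕ, generalizedTuran n (SimpleGraph.cycleGraph 4) (cycleFamily A) = 0) ∧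
    (∀ k : ℕ, 4 ∉ A → IsLeast {a | a ∈ A ∧ Even a} (2 * k) →
      (fun n : ℕ => (generalizedTuran n (SimpleGraph.cycleGraph 4) (cycleFamily A) : ℝ))
        ~[atTop] fun n : ℕ => ((k : ℝ) - 1) * ((k : ℝ) - 2) / 4 * (n : ℝ) ^ 2) ∧
    ({a | a ∈ A ∧ Even a} = ∅ →
      (fun n : ℕ => (generalizedTuran n (SimpleGraph.cycleGraph 4) (cycleFamily A) : ℝ))
        ~[atTop] fun n : ℕ => (1 / 64 : ℝ) * (n : ℝ) ^ 4) := by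
  refine ⟨?_, ?_, ?_⟩
  · intro h4 n
    have h : (generalizedTuran n (SimpleGraph.cycleGraph 4) (cycleFamily A) : ℝ) ≤ 0 := by
      refine generalizedTuran_le le_rfl fun G hG => ?_
      have hfree : (SimpleGraph.cycleGraph 4).Free G := hG ⟨4, h4⟩
      rw [SimpleGraph.copyCount_eq_zero.mpr hfree, Nat.cast_zero]
    exact_mod_cast le_antisymm h (Nat.cast_nonneg _)
  · intro k h4 hleast
    have hkA := hleast.1.1
    have hk : 3 ≤ k := by
      have h3 := hA _ hkA
      have : k ≠ 2 := by
        rintro rfl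
        exact h4 hkA
      omega
    have hkR : (3 : ℝ) ≤ k := by exact_mod_cast hk
    refine isEquivalent_const_mul_pow (by
      have : 0 < ((k : ℝ) - 1) * ((k : ℝ) - 2) := mul_pos (by linarith) (by linarith)
      linarith) 2 ?_ ?_
    · intro δ hδ
      -- The side k - 1 is the largest that admits no cycle of length 2k; minimality of 2k then
      -- excludes all even members of the family at once.
      filter_upwards [eventually_le_copyCount_of_fixed_side (k - 1) hδ] with n hn
      have hcast : ((k - 1 : ℕ) : ℝ) = (k : ℝ) - 1 := by
        rw [Nat.cast_sub (by omega), Nat.cast_one]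
      rw [hcast, show (k : ℝ) - 1 - 1 = k - 2 by ring] at hn
      refine hn.trans (Nat.cast_le.mpr (copyCount_le_generalizedTuran ?_))
      rintro ⟨a, ha⟩
      rcases Nat.even_or_odd a with he | ho
      · have hka : 2 * k ≤ a := hleast.2 ⟨ha, he⟩
        obtain ⟨j, hj⟩ := he
        rw [← two_mul] at hj
        subst hj
        exact even_cycleGraph_free_completeBipartiteFin (by omega)
      · exact odd_cycleGraph_free_completeBipartiteFin (hA a ha) ho
    · intro δ hδ
      filter_upwards [eventually_copyCount_le_of_even_free hk hδ] with n hn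
      refine generalizedTuran_le ?_ fun G hG => hn G (hG ⟨2 * k, hkA⟩)
      have : 0 ≤ ((k : ℝ) - 1) * ((k : ℝ) - 2) := mul_nonneg (by linarith) (by linarith)
      positivity
  · intro hempty
    have hodd : ∀ a ∈ A, Odd a := fun a ha =>
      Nat.not_even_iff_odd.mp fun he => (Set.eq_empty_iff_forall_notMem.mp hempty a) ⟨ha, he⟩
    refine isEquivalent_const_mul_pow (by norm_num) 4 ?_ ?_
    · intro δ hδ
      filter_upwards [eventually_le_copyCount_of_half hδ] with n hn
      refine hn.trans (Nat.cast_le.mpr (copyCount_le_generalizedTuran ?_))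
      rintro ⟨a, ha⟩
      exact odd_cycleGraph_free_completeBipartiteFin (hA a ha) (hodd a ha)
    · intro δ hδ
      obtain ⟨a, ha⟩ := hne
      obtain ⟨l, rfl⟩ := hodd a ha
      have hl := hA _ ha
      filter_upwards [eventually_copyCount_le_of_odd_free (l := l) (by omega) hδ] with n hn
      exact generalizedTuran_le (by positivity) fun G hG => hn G (hG ⟨2 * l + 1, ha⟩)
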